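/- Let $\mathbb K$ be a finite field. A *bipersistence module* $M$ assigns to each $p\in\mathbb R^2$ a $\mathbb K$-vector space $M_p$ and to each $p\le q$ (coordinatewise order) a linear map $M_{p\to q}$, with $M_{p\to p}=\mathrm{id}$ and $M_{q\to r}\circ M_{p\to q}=M_{p\to r}$; one-parameter persistence modules are defined in the same way over $\mathbb R$. A *finite presentation* $P$ is a $k\times m$ matrix over $\mathbb K$ whose rows and columns are labelled by bigrades in $\mathbb R^2$, such that $P_{ij}\neq0$ implies $\mathrm{gr}(\mathrm{row}_i)\le\mathrm{gr}(\mathrm{col}_j)$. It defines the module with $$M^P_p=\mathrm{span}\{e_i\mid \mathrm{gr}(\mathrm{row}_i)\le p\}\,/\,\mathrm{span}\{\mathrm{col}_j\mid \mathrm{gr}(\mathrm{col}_j)\le p\}$$ and the maps induced by inclusion; $P$ is a presentation of $M$ if $M\cong M^P$. A *slice* is a line $\ell: y=sx+t$ with $s>0$; put $\lambda_\ell(x)=\bigl(\tfrac{x}{\sqrt{1+s^2}},\,\tfrac{sx}{\sqrt{1+s^2}}+t\bigr)$, let $M^\ell$ be the one-parameter module with $M^\ell_x=M_{\lambda_\ell(x)}$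 and the maps of $M$, and let $w(\ell)=\frac1{\sqrt{1+s^2}}$ if $s\ge1$ and $w(\ell)=\frac1{\sqrt{1+1/s^2}}$ if $s<1$. For finitely presented $M$, the persistence diagram $D(M^\ell)$ is the finite multiset of points $(b,d)$, $b\in\mathbb R$, $d\in\mathbb R\cup\{\infty\}$, $b<d$, such that $M^\ell$ is isomorphic to the direct sum of the interval modules of the $[b,d)$. The bottleneck distance $d_B(M^\ell,N^\ell)\in[0,\infty]$ is the minimum cost of a partial matching between $D(M^\ell)$ and $D(N^\ell)$, where the cost is the maximum of $\max(|a-c|,|b-d|)$ over matched pairs $(a,b),(c,d)$ and of $(b-a)/2$ over unmatched points $(a,b)$, with $\infty-\infty=0$ and $\max\emptyset=0$. The *matching distance* is $$d_{\mathrm{match}}(M,N)=\sup_{\ell}\,w(\ell)\,d_B(M^\ell,N^\ell)\in[0,\infty].$$ **Theorem.** Let $M$ and $N$ be bipersistence modules with finite presentations $P^M$ and $P^N$ all of whose row and column bigrades lie in $\mathbb Q^2$. Then either $d_B(M^\ell,N^\ell)=\infty$ for every slice $\ell$, or $d_{\mathrm{match}}(M,N)$ is a (finite, non-negative) rational number.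 -/

import Mathlib

open scoped ENNReal NNReal

universe u v w z

noncomputable section

/-! ## Persistence modules over a preordered set of parameters -/

/-- A persistence module over the preordered set `X` (`X = ℝ`: one parameter,
`X = ℝ × ℝ` with the coordinatewise order: a bipersistence module). -/
structure PersistenceModule (K : Type u) [Field K] (X : Type w) [Preorder X] where
  obj : X → Type v
  [addCommGroup : ∀ x, AddCommGroup (obj x)]
  [module : ∀ x, Module K (obj x)]
  map : ∀ {x y : X}, x ≤ y → (obj x →ₗ[K] obj y)
  map_refl : ∀ x : X, map (le_refl x) = LinearMap.id
  map_trans : ∀ {x y z : X} (hxy : x ≤ y) (hyz : y ≤ z),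
    map hyz ∘ₗ map hxy = map (hxy.trans hyz)

attribute [instance] PersistenceModule.addCommGroup PersistenceModule.module

namespace PersistenceModule

variable {K : Type u} [Field K] {X : Type w} [Preorder X]

/-- An isomorphism of persistence modules: linear isomorphisms at every parameter that commute
with the structure maps. -/
structure Iso (M : PersistenceModule.{u, v} K X) (N : PersistenceModule.{u, z} K X) where
  equiv : ∀ x, M.obj x ≃ₗ[K] N.obj x
  comm : ∀ {x y : X} (h : x ≤ y) (a : M.obj x), equiv y (M.map h a) = N.map h (equiv x a)

/-- Restriction of a persistence module along an order-preserving map. -/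
def pullback {Y : Type z} [Preorder Y] (M : PersistenceModule.{u, v} K X) (f : Y →o X) :
    PersistenceModule.{u, v} K Y where
  obj y := M.obj (f y)
  map h := M.map (f.monotone h)
  map_refl y := M.map_refl (f y)
  map_trans h h' := M.map_trans (f.monotone h) (f.monotone h')

/-- The direct sum of a finite family of persistence modules. -/
def directSum {n : ℕ} (M : Fin n → PersistenceModule.{u, v} K X) :
    PersistenceModule.{u, v} K X where
  obj x := ∀ i, (M i).obj x
  map h := LinearMap.pi fun i => (M i).map h ∘ₗ LinearMap.proj i
  map_refl x := by
    refine LinearMap.ext fun a => funext fun i => ?_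
    exact LinearMap.congr_fun ((M i).map_refl x) (a i)
  map_trans h h' := by
    refine LinearMap.ext fun a => funext fun i => ?_
    exact LinearMap.congr_fun ((M i).map_trans h h') (a i)

open Classical in
/-- The interval module of `[b, d)`, where `d` may be `∞`: at `x` it consists of the functions
to `K` on the proofs of `b ≤ x < d`, so it is a copy of `K` if `b ≤ x < d` and zero otherwise.
The maps between parameters in `[b, d)` are the identity. -/
def interval (K : Type u) [Field K] (b : ℝ) (d : WithTop ℝ) : PersistenceModule.{u, u} K ℝ where
  obj x := PLift (b ≤ x ∧ (x : WithTop ℝ) < d) → K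
  map {x _} _ := LinearMap.pi fun _ =>
    if hx : b ≤ x ∧ (x : WithTop ℝ) < d then LinearMap.proj (PLift.up hx) else 0
  map_refl x := by
    refine LinearMap.ext fun a => funext fun ⟨hx⟩ => ?_
    simp [hx]
  map_trans {x y z} hxy hyz := by
    refine LinearMap.ext fun a => funext fun ⟨hz⟩ => ?_
    by_cases hx : b ≤ x ∧ (x : WithTop ℝ) < d
    · have hy : b ≤ y ∧ (y : WithTop ℝ) < d :=
        ⟨hx.1.trans hxy, lt_of_le_of_lt (WithTop.coe_le_coe.2 hyz) hz.2⟩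
      simp [hx, hy]
    · by_cases hy : b ≤ y ∧ (y : WithTop ℝ) < d <;> simp [hx, hy]

end PersistenceModule

/-! ## Finite presentations -/

/-- A finite presentation: a `k × m` matrix over `K` whose rows (generators) and columns
(relations) are labelled by grades in `X`, such that a nonzero entry forces
`gr (row i) ≤ gr (col j)`. -/
structure FinitePresentation (K : Type u) [Field K] (X : Type w) [Preorder X] where
  numRows : ℕ
  numCols : ℕ
  rowGrade : Fin numRows → X
  colGrade : Fin numCols → X
  mat : Matrix (Fin numRows) (Fin numCols) K
  grade_le : ∀ i j, mat i j ≠ 0 → rowGrade i ≤ colGrade j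

namespace FinitePresentation

variable {K : Type u} [Field K] {X : Type w} [Preorder X]

/-- The span of the generators of grade at most `x`. -/
def gen (P : FinitePresentation K X) (x : X) : Submodule K (Fin P.numRows → K) :=
  Submodule.span K {e | ∃ i, P.rowGrade i ≤ x ∧ e = Pi.single i 1}

/-- The span of the columns of grade at most `x`. -/
def rel (P : FinitePresentation K X) (x : X) : Submodule K (Fin P.numRows → K) :=
  Submodule.span K {c | ∃ j, P.colGrade j ≤ x ∧ c = fun i => P.mat i j}

theorem gen_mono (P : FinitePresentation K X) {x y : X} (h : x ≤ y) : P.gen x ≤ P.gen y :=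
  Submodule.span_mono fun _ ⟨i, hi, he⟩ => ⟨i, hi.trans h, he⟩

theorem rel_mono (P : FinitePresentation K X) {x y : X} (h : x ≤ y) : P.rel x ≤ P.rel y :=
  Submodule.span_mono fun _ ⟨i, hi, he⟩ => ⟨i, hi.trans h, he⟩

theorem rel_le_gen (P : FinitePresentation K X) (x : X) : P.rel x ≤ P.gen x := by
  refine Submodule.span_le.2 ?_
  rintro _ ⟨j, hj, rfl⟩
  rw [SetLike.mem_coe, pi_eq_sum_univ' (fun i => P.mat i j)]
  refine Submodule.sum_mem _ fun i _ => ?_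
  by_cases h : P.mat i j = 0
  · rw [h, zero_smul]
    exact Submodule.zero_mem _
  · refine Submodule.smul_mem _ _ (Submodule.subset_span ⟨i, (P.grade_le i j h).trans hj, ?_⟩)
    ext l
    simp [Pi.single_apply, eq_comm]

/-- The persistence module of a finite presentation: at `x` it is
`span (Gen_x) / span (Rel_x)`, with the maps induced by the inclusions of the spans. -/
def toModule (P : FinitePresentation K X) : PersistenceModule.{u, u} K X where
  obj x := ↥(P.gen x) ⧸ (P.rel x).submoduleOf (P.gen x)
  map {x y} h := Submodule.mapQ _ _ (Submodule.inclusion (P.gen_mono h))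
    (fun _ ha => P.rel_mono h ha)
  map_refl x := by
    refine Submodule.linearMap_qext _ (LinearMap.ext fun a => ?_)
    rfl
  map_trans h h' := by
    refine Submodule.linearMap_qext _ (LinearMap.ext fun a => ?_)
    rfl

/-- `P` is a presentation of `M`. -/
def Presents (P : FinitePresentation K X) (M : PersistenceModule.{u, v} K X) : Prop :=
  Nonempty (PersistenceModule.Iso M P.toModule)

end FinitePresentation

/-! ## Persistence diagrams and the bottleneck distance -/

/-- A persistence diagram: a finite multiset of points `(b, d)` with `b` real, `d` real or `∞`,
and `b < d`, given as a finite family (every notion below is invariant under reindexing). -/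
structure PersistenceDiagram where
  size : ℕ
  birth : Fin size → ℝ
  death : Fin size → WithTop ℝ
  lt : ∀ i, (birth i : WithTop ℝ) < death i

namespace PersistenceDiagram

/-- The distance between two second coordinates, with `∞ - ∞ = 0`. -/
def deathDist : WithTop ℝ → WithTop ℝ → ℝ≥0∞
  | some b, some d => ENNReal.ofReal |b - d|
  | none, none => 0
  | some _, none => ∞
  | none, some _ => ∞

/-- Half the length of `[b, d)`. -/
def halfLength : ℝ → WithTop ℝ → ℝ≥0∞
  | b, some d => ENNReal.ofReal ((d - b) / 2)
  | _, none => ∞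

/-- The cost of a partial matching `σ` (a bijection from a sub-multiset of `D₁` to a sub-multiset
of `D₂`): the largest `l^∞`-distance of matched points or half-length of unmatched points.
The maximum of no numbers is `0`. -/
def cost (D₁ D₂ : PersistenceDiagram) (σ : Fin D₁.size ≃. Fin D₂.size) : ℝ≥0∞ :=
  (⨆ (i) (j) (_ : σ i = some j),
      max (ENNReal.ofReal |D₁.birth i - D₂.birth j|) (deathDist (D₁.death i) (D₂.death j))) ⊔
    ((⨆ (i) (_ : σ i = none), halfLength (D₁.birth i) (D₁.death i)) ⊔
      ⨆ (j) (_ : σ.symm j = none), halfLength (D₂.birth j) (D₂.death j))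

/-- The bottleneck distance of two persistence diagrams (a minimum over finitely many partial
matchings), with values in `[0, ∞]`. -/
def bottleneckDist (D₁ D₂ : PersistenceDiagram) : ℝ≥0∞ :=
  ⨅ σ : Fin D₁.size ≃. Fin D₂.size, cost D₁ D₂ σ

/-- The direct sum of the interval modules of the points of a persistence diagram. -/
def toModule (K : Type u) [Field K] (D : PersistenceDiagram) : PersistenceModule.{u, u} K ℝ :=
  PersistenceModule.directSum fun i => PersistenceModule.interval K (D.birth i) (D.death i)

end PersistenceDiagram

namespace PersistenceModule

variable {K : Type u} [Field K]

/-- `D` is a persistence diagram of `M`: `M` is the direct sum of the interval modules `[b, d)`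
with `(b, d)` in `D`. -/
def IsDiagram (M : PersistenceModule.{u, v} K ℝ) (D : PersistenceDiagram) : Prop :=
  Nonempty (Iso M (D.toModule K))

open Classical in
/-- The persistence diagram of `M`. It exists whenever `M` is finitely presented, and it is then
unique up to reindexing; modules without a diagram get the empty one, as a dummy value. -/
def diagram (M : PersistenceModule.{u, v} K ℝ) : PersistenceDiagram :=
  if h : ∃ D, M.IsDiagram D then h.choose else ⟨0, Fin.elim0, Fin.elim0, fun i => i.elim0⟩

/-- The bottleneck distance of two one-parameter persistence modules. -/
def bottleneckDist (M : PersistenceModule.{u, v} K ℝ) (N : PersistenceModule.{u, z} K ℝ) :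
    ℝ≥0∞ :=
  PersistenceDiagram.bottleneckDist M.diagram N.diagram

end PersistenceModule

/-! ## Slices and the matching distance -/

/-- A slice: the line `y = s x + t` with `s > 0`. -/
structure Slice where
  s : ℝ
  t : ℝ
  s_pos : 0 < s

namespace Slice

/-- The order-preserving isometric parameterization of the slice,
`x ↦ (x / √(1 + s²), s x / √(1 + s²) + t)`. -/
def param (l : Slice) : ℝ →o ℝ × ℝ where
  toFun x := (x / √(1 + l.s ^ 2), l.s * (x / √(1 + l.s ^ 2)) + l.t)
  monotone' x y h := by
    have h1 : x / √(1 + l.s ^ 2) ≤ y / √(1 + l.s ^ 2) := by gcongr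
    exact ⟨h1, by have := l.s_pos.le; dsimp only; gcongr⟩

/-- The weight of a slice. -/
def weight (l : Slice) : ℝ :=
  if 1 ≤ l.s then 1 / √(1 + l.s ^ 2) else 1 / √(1 + 1 / l.s ^ 2)

end Slice

namespace PersistenceModule

variable {K : Type u} [Field K]

/-- The slice module `M^l`. -/
def slice (M : PersistenceModule.{u, v} K (ℝ × ℝ)) (l : Slice) : PersistenceModule.{u, v} K ℝ :=
  M.pullback l.param

/-- The matching distance: the supremum over all slices of the weighted bottleneck distance of
the slice modules, with values in `[0, ∞]`. -/
def matchingDist (M : PersistenceModule.{u, v} K (ℝ × ℝ))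
    (N : PersistenceModule.{u, z} K (ℝ × ℝ)) : ℝ≥0∞ :=
  ⨆ l : Slice, ENNReal.ofReal l.weight * bottleneckDist (M.slice l) (N.slice l)

end PersistenceModule

/-- All row and column bigrades of the presentation are rational points of the plane. -/
def FinitePresentation.HasRationalGrades {K : Type u} [Field K]
    (P : FinitePresentation K (ℝ × ℝ)) : Prop :=
  (∀ i, ∃ a b : ℚ, P.rowGrade i = ((a : ℝ), (b : ℝ))) ∧
    ∀ j, ∃ a b : ℚ, P.colGrade j = ((a : ℝ), (b : ℝ))

end

-- A slice enters the quadrant above a bigrade `p` at the parameter `push p`. Multiplying by the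
-- weight cancels the square root: for `s ≥ 1` the weighted value is `max p.1 (a * p.2 - b)` with
-- `(a, b) = (1/s, t/s)`, and for `s < 1` it is `max (a * p.1) (p.2 - b)` with `(a, b) = (s, t)`. At
-- rational `p` both are maxima of two affine functions of `(a, b)` with rational coefficients.
--
-- The diagram of a slice is governed by the preorder that `push` induces on the finitely many
-- grades: once this preorder is fixed, births and deaths are the pushes of fixed bigrades
-- (`exists_bigradedDiagram`). There are finitely many preorders and partial matchings, so "`v` is
-- at most the weighted bottleneck distance" is a Boolean combination of rational affine
-- inequalities in `(v, a, b)`. Eliminating `b` and `a` as in Fourier–Motzkin (`exists_snd`) leaves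
-- such a condition on `v` alone, and the supremum of a nonempty bounded set of this kind is
-- rational (`exists_rat_eq_sSup`).
--
-- The number of infinite points is the number of rows minus the rank of the matrix, hence the same
-- on all slices. If it differs for the two modules, every distance is infinite. Otherwise, matching
-- the infinite points to each other and nothing else gives a uniform bound, because the weighted
-- push is 1-Lipschitz. Since `diagram` is a choice, existence and uniqueness of interval
-- decompositions are proved along the way.

universe v'

/-! ## Semilinear predicates and quantifier elimination -/

/-- The predicates obtained from the inequalities `0 ≤ f`, `f ∈ A`, by negations and
conjunctions. -/
inductive SemilinearPred {X : Type*} (A : Submodule ℚ (X → ℝ)) : (X → Prop) → Prop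
  | nonneg {f : X → ℝ} (hf : f ∈ A) : SemilinearPred A (fun x => 0 ≤ f x)
  | not {p : X → Prop} (hp : SemilinearPred A p) : SemilinearPred A (fun x => ¬ p x)
  | and {p q : X → Prop} (hp : SemilinearPred A p) (hq : SemilinearPred A q) :
      SemilinearPred A (fun x => p x ∧ q x)

namespace SemilinearPred

variable {X : Type*} {A : Submodule ℚ (X → ℝ)}

theorem congr {p q : X → Prop} (hp : SemilinearPred A p) (h : ∀ x, q x ↔ p x) :
    SemilinearPred A q := by
  have : q = p := funext fun x => propext (h x)
  exact this ▸ hp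

theorem or {p q : X → Prop} (hp : SemilinearPred A p) (hq : SemilinearPred A q) :
    SemilinearPred A (fun x => p x ∨ q x) :=
  (hp.not.and hq.not).not.congr fun x => by tauto

theorem iff {p q : X → Prop} (hp : SemilinearPred A p) (hq : SemilinearPred A q) :
    SemilinearPred A (fun x => p x ↔ q x) :=
  ((hp.and hq).or (hp.not.and hq.not)).congr fun x => by tauto

theorem le {f g : X → ℝ} (hf : f ∈ A) (hg : g ∈ A) : SemilinearPred A (fun x => f x ≤ g x) :=
  (nonneg (A.sub_mem hg hf)).congr fun x => by simp

theorem lt {f g : X → ℝ} (hf : f ∈ A) (hg : g ∈ A) : SemilinearPred A (fun x => f x < g x) :=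
  (le hg hf).not.congr fun x => by simp

theorem const (A : Submodule ℚ (X → ℝ)) (P : Prop) : SemilinearPred A (fun _ => P) := by
  have h : SemilinearPred A (fun _ => (0 : ℝ) ≤ 0) := nonneg (f := 0) A.zero_mem
  by_cases hP : P
  · exact h.congr fun _ => by simp [hP]
  · exact h.not.congr fun _ => by simp [hP]

theorem exists_mem {ι : Type*} (s : Finset ι) {p : ι → X → Prop}
    (hp : ∀ i ∈ s, SemilinearPred A (p i)) : SemilinearPred A (fun x => ∃ i ∈ s, p i x) := by
  classical
  induction s using Finset.induction_on with
  | empty => exact (const A False).congr fun x => by simp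
  | insert i s _ ih =>
    refine ((hp i (Finset.mem_insert_self i s)).or
      (ih fun j hj => hp j (Finset.mem_insert_of_mem hj))).congr fun x => ?_
    simp

theorem exists_finite {ι : Type*} [Finite ι] {p : ι → X → Prop}
    (hp : ∀ i, SemilinearPred A (p i)) : SemilinearPred A (fun x => ∃ i, p i x) := by
  have := Fintype.ofFinite ι
  exact (exists_mem Finset.univ fun i _ => hp i).congr fun x => by simp

theorem forall_finite {ι : Type*} [Finite ι] {p : ι → X → Prop}
    (hp : ∀ i, SemilinearPred A (p i)) : SemilinearPred A (fun x => ∀ i, p i x) :=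
  (exists_finite fun i => (hp i).not).not.congr fun x => by simp

end SemilinearPred

/-- The functions `(x, y) ↦ g x + q * y` on `X × ℝ` with `g ∈ A` and `q` rational. -/
def adjoinCoord {X : Type*} (A : Submodule ℚ (X → ℝ)) : Submodule ℚ (X × ℝ → ℝ) where
  carrier := {f | ∃ g ∈ A, ∃ q : ℚ, f = fun z => g z.1 + q * z.2}
  zero_mem' := ⟨0, A.zero_mem, 0, by ext; simp⟩
  add_mem' := by
    rintro _ _ ⟨g, hg, q, rfl⟩ ⟨g', hg', q', rfl⟩
    exact ⟨g + g', A.add_mem hg hg', q + q', by ext; simp; ring⟩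
  smul_mem' := by
    rintro c _ ⟨g, hg, q, rfl⟩
    exact ⟨c • g, A.smul_mem c hg, c * q, by ext; simp [Rat.smul_def]; ring⟩

theorem comp_fst_mem_adjoinCoord {X : Type*} {A : Submodule ℚ (X → ℝ)} {g : X → ℝ} (hg : g ∈ A) :
    (fun z : X × ℝ => g z.1) ∈ adjoinCoord A :=
  ⟨g, hg, 0, by ext; simp⟩

theorem snd_mem_adjoinCoord {X : Type*} (A : Submodule ℚ (X → ℝ)) :
    (fun z : X × ℝ => z.2) ∈ adjoinCoord A :=
  ⟨0, A.zero_mem, 1, by ext; simp⟩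

namespace SemilinearPred

variable {X : Type*} {A : Submodule ℚ (X → ℝ)}

/-- Substituting a test point for the variable to be eliminated stays within `A`, because the
coefficient of that variable is rational and `A` is a rational subspace. -/
theorem comp_graph {p : X × ℝ → Prop} (hp : SemilinearPred (adjoinCoord A) p) {t : X → ℝ}
    (ht : t ∈ A) : SemilinearPred A (fun x => p (x, t x)) := by
  induction hp with
  | nonneg hf =>
    obtain ⟨g, hg, q, rfl⟩ := hf
    exact (nonneg (A.add_mem hg (A.smul_mem q ht))).congr fun x => by simp [Rat.smul_def]
  | not _ ih => exact ih.not
  | and _ _ ih ih' => exact ih.and ih'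

/-- For fixed `x`, a semilinear predicate of `(x, y)` depends only on the position of `y` relative
to finitely many thresholds. -/
theorem exists_thresholds {p : X × ℝ → Prop} (hp : SemilinearPred (adjoinCoord A) p) :
    ∃ T : Finset (X → ℝ), (∀ t ∈ T, t ∈ A) ∧ ∀ x y y',
      (∀ t ∈ T, (t x < y ↔ t x < y') ∧ (y < t x ↔ y' < t x)) → (p (x, y) ↔ p (x, y')) := by
  classical
  induction hp with
  | nonneg hf =>
    obtain ⟨g, hg, q, rfl⟩ := hf
    rcases eq_or_ne q 0 with rfl | hq
    · exact ⟨∅, by simp, by simp⟩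
    -- The only threshold is the zero of `y ↦ g x + q * y`.
    · refine ⟨{(-q⁻¹) • g}, by simpa using A.smul_mem q⁻¹ hg, fun x y y' h => ?_⟩
      have h' := h _ (Finset.mem_singleton_self _)
      have hqr : (q : ℝ) ≠ 0 := by exact_mod_cast hq
      have hg' : g x = -(q * (((-q⁻¹) • g) x)) := by
        simp [Rat.smul_def, hqr]
      generalize ((-q⁻¹) • g) x = t at h' hg'
      dsimp only
      rw [hg']
      rcases lt_or_gt_of_ne hqr with hneg | hpos
      · have key : ∀ y : ℝ, 0 ≤ -(q * t) + q * y ↔ ¬ t < y := fun y => by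
          rw [not_lt]; constructor <;> intro h <;> nlinarith
        rw [key, key, h'.1]
      · have key : ∀ y : ℝ, 0 ≤ -(q * t) + q * y ↔ ¬ y < t := fun y => by
          rw [not_lt]; constructor <;> intro h <;> nlinarith
        rw [key, key, h'.2]
  | not _ ih =>
    obtain ⟨T, hT, h⟩ := ih
    exact ⟨T, hT, fun x y y' hy => not_congr (h x y y' hy)⟩
  | and _ _ ih ih' =>
    obtain ⟨T, hT, h⟩ := ih
    obtain ⟨T', hT', h'⟩ := ih'
    refine ⟨T ∪ T', fun t ht => (Finset.mem_union.1 ht).elim (hT t) (hT' t), fun x y y' hy => ?_⟩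
    exact and_congr (h x y y' fun t ht => hy t (Finset.mem_union_left _ ht))
      (h' x y y' fun t ht => hy t (Finset.mem_union_right _ ht))

/-- Every real number has the same position relative to a finite family as one of finitely many
test points. -/
theorem exists_testPoint {ι : Type*} (s : Finset ι) (hs : s.Nonempty) (t : ι → ℝ) (y : ℝ) :
    ∃ i ∈ s, ∃ j ∈ s, ∃ y', (y' = (t i + t j) / 2 ∨ y' = t i + 1 ∨ y' = t i - 1) ∧
      ∀ k ∈ s, (t k < y ↔ t k < y') ∧ (y < t k ↔ y' < t k) := by
  by_cases hy : ∃ i ∈ s, t i = y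
  · obtain ⟨i, hi, rfl⟩ := hy
    -- A threshold is the midpoint of itself with itself.
    exact ⟨i, hi, i, hi, t i, Or.inl (by ring), by simp⟩
  have hne : ∀ k ∈ s, t k ≠ y := fun k hk h => hy ⟨k, hk, h⟩
  by_cases hL : ∃ i ∈ s, t i < y
  · obtain ⟨i, hi, hmax⟩ := (s.filter (t · < y)).exists_max_image t
      (by obtain ⟨i, hi, h⟩ := hL; exact ⟨i, by simp [hi, h]⟩)
    simp only [Finset.mem_filter] at hi hmax
    by_cases hU : ∃ j ∈ s, y < t j
    · obtain ⟨j, hj, hmin⟩ := (s.filter (y < t ·)).exists_min_image t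
        (by obtain ⟨i, hi, h⟩ := hU; exact ⟨i, by simp [hi, h]⟩)
      simp only [Finset.mem_filter] at hj hmin
      refine ⟨i, hi.1, j, hj.1, _, Or.inl rfl, fun k hk => ?_⟩
      rcases lt_or_gt_of_ne (hne k hk) with h | h
      · have := hmax k ⟨hk, h⟩
        constructor <;> constructor <;> intro <;> linarith
      · have := hmin k ⟨hk, h⟩
        constructor <;> constructor <;> intro <;> linarith
    · push Not at hU
      refine ⟨i, hi.1, i, hi.1, _, Or.inr (Or.inl rfl), fun k hk => ?_⟩
      have h := lt_of_le_of_ne (hU k hk) (hne k hk)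
      have := hmax k ⟨hk, h⟩
      constructor <;> constructor <;> intro <;> linarith
  · push Not at hL
    obtain ⟨i, hi, hmin⟩ := s.exists_min_image t hs
    refine ⟨i, hi, i, hi, _, Or.inr (Or.inr rfl), fun k hk => ?_⟩
    have h := lt_of_le_of_ne (hL k hk) (hne k hk).symm
    have := hmin k hk
    constructor <;> constructor <;> intro <;> linarith

/-- Elimination of an existential quantifier. -/
theorem exists_snd {p : X × ℝ → Prop} (hp : SemilinearPred (adjoinCoord A) p)
    (h1 : (fun _ => 1) ∈ A) : SemilinearPred A (fun x => ∃ y, p (x, y)) := by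
  classical
  obtain ⟨T, hT, h⟩ := hp.exists_thresholds
  -- Adding `0` makes the set of thresholds nonempty, so that test points exist even when `T` is
  -- empty.
  have hT' : ∀ t ∈ insert 0 T, t ∈ A := fun t ht =>
    (Finset.mem_insert.1 ht).elim (fun h => h ▸ A.zero_mem) (hT t)
  have key : SemilinearPred A (fun x => ∃ t ∈ insert 0 T, ∃ t' ∈ insert 0 T,
      p (x, (t x + t' x) / 2) ∨ p (x, t x + 1) ∨ p (x, t x - 1)) := by
    refine exists_mem _ fun t ht => exists_mem _ fun t' ht' => ?_
    refine .or ?_ (.or ?_ ?_)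
    · refine (hp.comp_graph (A.smul_mem (1 / 2) (A.add_mem (hT' t ht) (hT' t' ht')))).congr
        fun x => ?_
      simp [Rat.smul_def, div_eq_inv_mul, mul_add]
    · exact hp.comp_graph (A.add_mem (hT' t ht) h1)
    · exact hp.comp_graph (A.sub_mem (hT' t ht) h1)
  refine key.congr fun x => ⟨?_, ?_⟩
  · rintro ⟨y, hy⟩
    obtain ⟨t, ht, t', ht', y', hy', hiff⟩ :=
      exists_testPoint (insert 0 T) (Finset.insert_nonempty 0 T) (fun t => t x) y
    have := (h x y y' fun t ht => hiff t (Finset.mem_insert_of_mem ht)).1 hy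
    refine ⟨t, ht, t', ht', ?_⟩
    rcases hy' with rfl | rfl | rfl <;> simp [this]
  · rintro ⟨t, _, t', _, hp | hp | hp⟩ <;> exact ⟨_, hp⟩

end SemilinearPred

/-- The rational constants. -/
def ratConst : Submodule ℚ (Unit → ℝ) where
  carrier := {f | ∃ q : ℚ, f = fun _ => (q : ℝ)}
  zero_mem' := ⟨0, by ext; simp⟩
  add_mem' := by
    rintro _ _ ⟨q, rfl⟩ ⟨q', rfl⟩
    exact ⟨q + q', by ext; simp⟩
  smul_mem' := by
    rintro c _ ⟨q, rfl⟩
    exact ⟨c * q, by ext; simp [Rat.smul_def]⟩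

/-- The supremum of a bounded semilinear set of real numbers is rational. -/
theorem SemilinearPred.exists_rat_eq_sSup {p : Unit × ℝ → Prop}
    (hp : SemilinearPred (adjoinCoord ratConst) p) (hne : {v | p ((), v)}.Nonempty)
    (hbdd : BddAbove {v | p ((), v)}) : ∃ q : ℚ, sSup {v | p ((), v)} = q := by
  obtain ⟨T, hT, h⟩ := hp.exists_thresholds
  -- An irrational supremum is none of the thresholds, which are rational constants. Then `p` is
  -- constant near it, so `p` holds slightly beyond the supremum.
  by_contra hq
  set V := sSup {v | p ((), v)} with hV
  have hVT : ∀ t ∈ T, t () ≠ V := by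
    intro t ht htV
    obtain ⟨q, rfl⟩ := hT t ht
    exact hq ⟨q, htV.symm⟩
  have hev : ∀ᶠ v in nhds V, ∀ t ∈ T, (t () < v ↔ t () < V) ∧ (v < t () ↔ V < t ()) := by
    rw [Filter.eventually_all_finset]
    intro t ht
    rcases lt_or_gt_of_ne (hVT t ht) with h | h
    · filter_upwards [lt_mem_nhds h] with v hv
      exact ⟨by simp [hv, h], by simp [hv.not_gt, h.not_gt]⟩
    · filter_upwards [gt_mem_nhds h] with v hv
      exact ⟨by simp [hv.not_gt, h.not_gt], by simp [hv, h]⟩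
  obtain ⟨ε, hε, hball⟩ := Metric.eventually_nhds_iff.1 hev
  obtain ⟨v, hv, hlt⟩ := exists_lt_of_lt_csSup hne (show V - ε < V by linarith)
  have hvV : v ≤ V := le_csSup hbdd hv
  have hpV : p ((), V) := (h () v V (hball (by
    rw [Real.dist_eq, abs_lt]; constructor <;> linarith))).1 hv
  have hpV' : p ((), V + ε / 2) := (h () (V + ε / 2) V (hball (by
    rw [Real.dist_eq, abs_lt]; constructor <;> linarith))).2 hpV
  have : V + ε / 2 ≤ V := le_csSup hbdd hpV'
  linarith

/-! ## Uniqueness of persistence diagrams -/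

namespace PersistenceModule

variable {K : Type u} [Field K] {X : Type w} [Preorder X]

def Iso.trans {M : PersistenceModule.{u, v} K X} {N : PersistenceModule.{u, z} K X}
    {L : PersistenceModule.{u, v'} K X} (f : Iso M N) (g : Iso N L) : Iso M L where
  equiv x := (f.equiv x).trans (g.equiv x)
  comm h a := by simp [f.comm, g.comm]

def Iso.pullback {Y : Type*} [Preorder Y] {M : PersistenceModule.{u, v} K X}
    {N : PersistenceModule.{u, z} K X} (f : Iso M N) (g : Y →o X) :
    Iso (M.pullback g) (N.pullback g) where
  equiv y := f.equiv (g y)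
  comm h a := f.comm (g.monotone h) a

theorem Iso.finrank_range_map {M : PersistenceModule.{u, v} K X}
    {N : PersistenceModule.{u, z} K X} (f : Iso M N) {x y : X} (h : x ≤ y) :
    Module.finrank K (LinearMap.range (M.map h)) =
      Module.finrank K (LinearMap.range (N.map h)) := by
  have hc : N.map h = (f.equiv y).toLinearMap ∘ₗ M.map h ∘ₗ (f.equiv x).symm.toLinearMap := by
    ext a
    simp [f.comm]
  rw [hc, LinearMap.range_comp, LinearMap.range_comp_of_range_eq_top _ (LinearEquiv.range _)]
  exact (LinearEquiv.finrank_map_eq (f.equiv y) _).symm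

end PersistenceModule

namespace PersistenceDiagram

open Classical in
/-- The number of points `(b, d)` with `b ≤ x` and `y < d`. -/
noncomputable def rankCount (D : PersistenceDiagram) (x y : ℝ) : ℕ :=
  (Finset.univ.filter fun i => D.birth i ≤ x ∧ (y : WithTop ℝ) < D.death i).card

/-- Only the intervals that contain both `x` and `y` contribute to the range, each a copy of `K`;
the map `Φ` extends families indexed by these intervals by zero. -/
theorem finrank_range_map_toModule (K : Type u) [Field K] (D : PersistenceDiagram) {x y : ℝ}
    (h : x ≤ y) : Module.finrank K (LinearMap.range ((D.toModule K).map h)) = D.rankCount x y := by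
  classical
  let S := {i // D.birth i ≤ x ∧ (y : WithTop ℝ) < D.death i}
  let Φ : (S → K) →ₗ[K] (D.toModule K).obj y :=
    LinearMap.pi fun i => LinearMap.pi fun _ =>
      if hi : D.birth i ≤ x ∧ (y : WithTop ℝ) < D.death i then LinearMap.proj (⟨i, hi⟩ : S) else 0
  have hΦ : ∀ f i u, Φ f i u =
      if hi : D.birth i ≤ x ∧ (y : WithTop ℝ) < D.death i then f ⟨i, hi⟩ else 0 := by
    intro f i u
    have : Φ f i u = (if hi : D.birth i ≤ x ∧ (y : WithTop ℝ) < D.death i then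
      (LinearMap.proj (⟨i, hi⟩ : S) : (S → K) →ₗ[K] K) else 0) f := rfl
    rw [this]
    split_ifs <;> rfl
  have hmap : ∀ (a : (D.toModule K).obj x) i u, (D.toModule K).map h a i u =
      if hi : D.birth i ≤ x ∧ (x : WithTop ℝ) < D.death i then a i (PLift.up hi) else 0 := by
    intro a i u
    have : (D.toModule K).map h a i u = (if hi : D.birth i ≤ x ∧ (x : WithTop ℝ) < D.death i then
      (LinearMap.proj (PLift.up hi) :
        (PLift (D.birth i ≤ x ∧ (x : WithTop ℝ) < D.death i) → K) →ₗ[K] K) else 0) (a i) := rfl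
    rw [this]
    split_ifs <;> rfl
  have hinj : Function.Injective Φ := by
    intro f g hfg
    ext ⟨i, hi⟩
    have := congrFun (congrFun hfg i) (PLift.up ⟨hi.1.trans h, hi.2⟩)
    rw [hΦ, hΦ] at this
    simpa [hi] using this
  have hxy : (x : WithTop ℝ) ≤ y := WithTop.coe_le_coe.2 h
  have hrange : LinearMap.range ((D.toModule K).map h) = LinearMap.range Φ := by
    apply le_antisymm
    · rintro _ ⟨a, rfl⟩
      refine ⟨fun i => a i.1 (PLift.up ⟨i.2.1, hxy.trans_lt i.2.2⟩), ?_⟩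
      funext i u
      rw [hΦ, hmap]
      by_cases hi : D.birth i ≤ x
      · have h1 : D.birth i ≤ x ∧ (y : WithTop ℝ) < D.death i := ⟨hi, u.down.2⟩
        have h2 : D.birth i ≤ x ∧ (x : WithTop ℝ) < D.death i := ⟨hi, hxy.trans_lt u.down.2⟩
        rw [dif_pos h1, dif_pos h2]
      · rw [dif_neg fun h => hi h.1, dif_neg fun h => hi h.1]
    · rintro _ ⟨f, rfl⟩
      let a : (D.toModule K).obj x := fun i _ =>
        if hi : D.birth i ≤ x ∧ (y : WithTop ℝ) < D.death i then f ⟨i, hi⟩ else 0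
      refine ⟨a, ?_⟩
      funext i u
      rw [hΦ, hmap]
      by_cases hi : D.birth i ≤ x
      · have h1 : D.birth i ≤ x ∧ (y : WithTop ℝ) < D.death i := ⟨hi, u.down.2⟩
        have h2 : D.birth i ≤ x ∧ (x : WithTop ℝ) < D.death i := ⟨hi, hxy.trans_lt u.down.2⟩
        rw [dif_pos h2]
      · rw [dif_neg fun h => hi h.1, dif_neg fun h => hi h.1]
  rw [hrange, LinearMap.finrank_range_of_inj hinj, Module.finrank_fintype_fun_eq_card,
    rankCount, Fintype.card_subtype]

/-- The multiplicity of a point. -/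
noncomputable def mult (D : PersistenceDiagram) (p : ℝ × WithTop ℝ) : ℕ := by
  classical exact (Finset.univ.filter fun i => (D.birth i, D.death i) = p).card

open Classical in
theorem rankCount_eq_sum (D : PersistenceDiagram) (S : Finset (ℝ × WithTop ℝ))
    (hS : ∀ i, (D.birth i, D.death i) ∈ S) (x y : ℝ) :
    D.rankCount x y = ∑ p ∈ S.filter fun p => p.1 ≤ x ∧ (y : WithTop ℝ) < p.2, D.mult p := by
  rw [rankCount, Finset.card_eq_sum_card_fiberwise (f := fun i => (D.birth i, D.death i))
    (t := S.filter fun p => p.1 ≤ x ∧ (y : WithTop ℝ) < p.2)]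
  · refine Finset.sum_congr rfl fun p hp => ?_
    rw [mult, Finset.filter_filter]
    congr 1
    ext i
    simp only [Finset.mem_filter, Finset.mem_univ, true_and, and_iff_right_iff_imp]
    rintro rfl
    exact (Finset.mem_filter.1 hp).2
  · intro i hi
    simpa [hS i] using hi

/-- Extremal counterexample: among the points of differing multiplicity, let `q` have the least
birth and, for that birth, the greatest death. Counting at `q.1` and at some `y` just below `q.2`
includes no other such point, so the counts differ. -/
theorem mult_eq_of_rankCount_eq {D D' : PersistenceDiagram}
    (h : ∀ x y, x ≤ y → D.rankCount x y = D'.rankCount x y) (p : ℝ × WithTop ℝ) :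
    D.mult p = D'.mult p := by
  classical
  by_contra hp
  let S : Finset (ℝ × WithTop ℝ) := Finset.univ.image (fun i => (D.birth i, D.death i)) ∪
    Finset.univ.image fun i => (D'.birth i, D'.death i)
  have hS : ∀ i, (D.birth i, D.death i) ∈ S := fun i =>
    Finset.mem_union_left _ (Finset.mem_image.2 ⟨i, Finset.mem_univ i, rfl⟩)
  have hS' : ∀ i, (D'.birth i, D'.death i) ∈ S := fun i =>
    Finset.mem_union_right _ (Finset.mem_image.2 ⟨i, Finset.mem_univ i, rfl⟩)
  have hlt : ∀ q ∈ S, (q.1 : WithTop ℝ) < q.2 := by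
    intro q hq
    simp only [S, Finset.mem_union, Finset.mem_image, Finset.mem_univ, true_and] at hq
    rcases hq with ⟨i, rfl⟩ | ⟨i, rfl⟩
    exacts [D.lt i, D'.lt i]
  have hout : ∀ q, D.mult q ≠ D'.mult q → q ∈ S := by
    intro q hq
    by_contra hqS
    refine hq ?_
    rw [mult, mult, Finset.card_eq_zero.2, Finset.card_eq_zero.2]
    · exact Finset.filter_eq_empty_iff.2 fun i _ hi => hqS (hi ▸ hS' i)
    · exact Finset.filter_eq_empty_iff.2 fun i _ hi => hqS (hi ▸ hS i)
  let B := S.filter fun q => D.mult q ≠ D'.mult q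
  obtain ⟨q₀, hq₀, hmin⟩ := B.exists_min_image Prod.fst
    ⟨p, Finset.mem_filter.2 ⟨hout p hp, hp⟩⟩
  obtain ⟨q, hq, hmax⟩ := (B.filter fun q => q.1 = q₀.1).exists_max_image Prod.snd
    ⟨q₀, by simp [hq₀]⟩
  obtain ⟨hqB, hq1⟩ := Finset.mem_filter.1 hq
  obtain ⟨hqS, hqne⟩ := Finset.mem_filter.1 hqB
  obtain ⟨y, hy, hyq, hyB⟩ : ∃ y : ℝ, q.1 ≤ y ∧ (y : WithTop ℝ) < q.2 ∧
      ∀ r ∈ B, r.2 < q.2 → r.2 ≤ y := by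
    have hcoe : ∀ d : WithTop ℝ, d ≠ ⊤ → ((d.untopD 0 : ℝ) : WithTop ℝ) = d := by
      intro d hd
      lift d to ℝ using hd
      rfl
    -- Including `q.1` ensures `q.1 ≤ y`, as the hypothesis on the counts requires.
    let T := insert q.1 ((B.filter fun r => r.2 < q.2).image fun r => r.2.untopD 0)
    have hT : T.Nonempty := Finset.insert_nonempty _ _
    refine ⟨T.max' hT, Finset.le_max' _ _ (Finset.mem_insert_self _ _), ?_, fun r hr hrq => ?_⟩
    · have := Finset.max'_mem T hT
      rcases Finset.mem_insert.1 this with h1 | h1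
      · rw [h1]; exact hlt q hqS
      · obtain ⟨r, hr, hrT⟩ := Finset.mem_image.1 h1
        have hrq := (Finset.mem_filter.1 hr).2
        rw [← hrT, hcoe _ hrq.ne_top]
        exact hrq
    · have hrT : r.2.untopD 0 ∈ T := Finset.mem_insert_of_mem
        (Finset.mem_image.2 ⟨r, Finset.mem_filter.2 ⟨hr, hrq⟩, rfl⟩)
      have : r.2.untopD 0 ≤ T.max' hT := Finset.le_max' _ _ hrT
      rw [← hcoe _ hrq.ne_top]
      exact WithTop.coe_le_coe.2 this
  have hsum := h q.1 y hy
  rw [rankCount_eq_sum D S hS, rankCount_eq_sum D' S hS'] at hsum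
  have hmem : q ∈ S.filter fun p => p.1 ≤ q.1 ∧ (y : WithTop ℝ) < p.2 := by
    simp [hqS, hyq]
  rw [← Finset.add_sum_erase _ _ hmem, ← Finset.add_sum_erase _ _ hmem] at hsum
  have hrest : ∀ r ∈ (S.filter fun p => p.1 ≤ q.1 ∧ (y : WithTop ℝ) < p.2).erase q,
      D.mult r = D'.mult r := by
    intro r hr
    obtain ⟨hrq, hr⟩ := Finset.mem_erase.1 hr
    obtain ⟨hrS, hr1, hry⟩ := Finset.mem_filter.1 hr
    by_contra hne
    have hrB : r ∈ B := Finset.mem_filter.2 ⟨hrS, hne⟩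
    have h1 : r.1 = q₀.1 := le_antisymm (hq1 ▸ hr1) (hmin r hrB)
    have h2 : r.2 ≤ q.2 := hmax r (Finset.mem_filter.2 ⟨hrB, h1⟩)
    rcases h2.lt_or_eq with h2 | h2
    · exact (hyB r hrB h2).not_gt hry
    · exact hrq (Prod.ext (h1.trans hq1.symm) h2)
  rw [Finset.sum_congr rfl hrest] at hsum
  exact hqne (Nat.add_right_cancel hsum)

/-- Two diagrams of the same module agree up to reindexing. -/
theorem exists_equiv_of_mult_eq {D D' : PersistenceDiagram}
    (h : ∀ p, D.mult p = D'.mult p) :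
    ∃ e : Fin D.size ≃ Fin D'.size,
      ∀ i, D'.birth (e i) = D.birth i ∧ D'.death (e i) = D.death i := by
  classical
  have hc : ∀ p, Nonempty ({i // (D.birth i, D.death i) = p} ≃
      {i // (D'.birth i, D'.death i) = p}) := by
    intro p
    refine ⟨Fintype.equivOfCardEq ?_⟩
    have := h p
    rw [mult, mult] at this
    rw [Fintype.card_subtype, Fintype.card_subtype]
    convert this
  refine ⟨Equiv.ofFiberEquiv fun p => (hc p).some, fun i => ?_⟩
  have := Equiv.ofFiberEquiv_map (fun p => (hc p).some) i
  exact ⟨congrArg Prod.fst this, congrArg Prod.snd this⟩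

end PersistenceDiagram

/-- The ranks of the structure maps are isomorphism invariants, and they determine all
multiplicities. -/
theorem PersistenceModule.IsDiagram.exists_equiv {K : Type u} [Field K]
    {M : PersistenceModule.{u, v} K ℝ} {D D' : PersistenceDiagram} (h : M.IsDiagram D)
    (h' : M.IsDiagram D') : ∃ e : Fin D.size ≃ Fin D'.size,
      ∀ i, D'.birth (e i) = D.birth i ∧ D'.death (e i) = D.death i := by
  obtain ⟨f⟩ := h
  obtain ⟨f'⟩ := h'
  refine PersistenceDiagram.exists_equiv_of_mult_eq
    (PersistenceDiagram.mult_eq_of_rankCount_eq fun x y hxy => ?_)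
  rw [← PersistenceDiagram.finrank_range_map_toModule K D hxy,
    ← PersistenceDiagram.finrank_range_map_toModule K D' hxy, ← f.finrank_range_map hxy,
    ← f'.finrank_range_map hxy]

namespace PersistenceDiagram

/-- Partial matchings are transported along the reindexings without raising the cost. Equality
follows by using reindexings in both directions. -/
theorem bottleneckDist_le_of_equiv {D₁ D₂ D₁' D₂' : PersistenceDiagram}
    (e₁ : Fin D₁.size ≃ Fin D₁'.size)
    (h₁ : ∀ i, D₁'.birth (e₁ i) = D₁.birth i ∧ D₁'.death (e₁ i) = D₁.death i)
    (e₂ : Fin D₂.size ≃ Fin D₂'.size)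
    (h₂ : ∀ i, D₂'.birth (e₂ i) = D₂.birth i ∧ D₂'.death (e₂ i) = D₂.death i) :
    bottleneckDist D₁ D₂ ≤ bottleneckDist D₁' D₂' := by
  refine le_iInf fun σ => ?_
  let τ : Fin D₁.size ≃. Fin D₂.size := (e₁.toPEquiv.trans σ).trans e₂.symm.toPEquiv
  have hτ : ∀ i j, τ i = some j ↔ σ (e₁ i) = some (e₂ j) := by
    intro i j
    simp only [τ, PEquiv.trans, Equiv.toPEquiv, PEquiv.coe_mk, Function.comp_apply, Option.bind_some]
    cases σ (e₁ i) <;> simp [Equiv.symm_apply_eq]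
  have hτ1 : ∀ i, τ i = none → σ (e₁ i) = none := by
    intro i hi
    by_contra hne
    obtain ⟨j, hj⟩ := Option.ne_none_iff_exists'.1 hne
    have := (hτ i (e₂.symm j)).2 (by simpa using hj)
    simp [hi] at this
  have hτ2 : ∀ j, τ.symm j = none → σ.symm (e₂ j) = none := by
    intro j hj
    by_contra hne
    obtain ⟨i, hi⟩ := Option.ne_none_iff_exists'.1 hne
    have hi' : σ i = some (e₂ j) := (PEquiv.eq_some_iff σ).1 hi
    have : τ (e₁.symm i) = some j := (hτ _ j).2 (by simpa using hi')
    have := (PEquiv.eq_some_iff τ).2 this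
    simp [hj] at this
  refine (iInf_le _ τ).trans ?_
  refine sup_le_sup ?_ (sup_le_sup ?_ ?_)
  · refine iSup_le fun i => iSup_le fun j => iSup_le fun hij => ?_
    refine le_iSup_of_le (e₁ i) (le_iSup_of_le (e₂ j) (le_iSup_of_le ((hτ i j).1 hij) ?_))
    rw [(h₁ i).1, (h₁ i).2, (h₂ j).1, (h₂ j).2]
  · refine iSup_le fun i => iSup_le fun hi => ?_
    refine le_iSup_of_le (e₁ i) (le_iSup_of_le (hτ1 i hi) ?_)
    rw [(h₁ i).1, (h₁ i).2]
  · refine iSup_le fun i => iSup_le fun hi => ?_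
    refine le_iSup_of_le (e₂ i) (le_iSup_of_le (hτ2 i hi) ?_)
    rw [(h₂ i).1, (h₂ i).2]

end PersistenceDiagram

namespace PersistenceModule

variable {K : Type u} [Field K]

theorem IsDiagram.diagram {M : PersistenceModule.{u, v} K ℝ} {D : PersistenceDiagram}
    (h : M.IsDiagram D) : M.IsDiagram M.diagram := by
  have hex : ∃ D, M.IsDiagram D := ⟨D, h⟩
  rw [PersistenceModule.diagram, dif_pos hex]
  exact hex.choose_spec

/-- Allows the chosen `diagram` to be replaced by any explicit one. -/
theorem bottleneckDist_eq_of_isDiagram {M : PersistenceModule.{u, v} K ℝ}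
    {N : PersistenceModule.{u, z} K ℝ} {D E : PersistenceDiagram} (hD : M.IsDiagram D)
    (hE : N.IsDiagram E) : bottleneckDist M N = PersistenceDiagram.bottleneckDist D E := by
  obtain ⟨e, he⟩ := hD.diagram.exists_equiv hD
  obtain ⟨f, hf⟩ := hE.diagram.exists_equiv hE
  obtain ⟨e', he'⟩ := hD.exists_equiv hD.diagram
  obtain ⟨f', hf'⟩ := hE.exists_equiv hE.diagram
  exact le_antisymm (PersistenceDiagram.bottleneckDist_le_of_equiv e he f hf)
    (PersistenceDiagram.bottleneckDist_le_of_equiv e' he' f' hf')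

end PersistenceModule

/-! ## Existence of persistence diagrams -/

theorem span_image_update_of_notMem {ι K V : Type*} [Field K] [AddCommGroup V] [Module K V]
    [DecidableEq ι] (e : ι → V) {i : ι} (v : V) {T : Set ι} (hi : i ∉ T) :
    Function.update e i v '' T = e '' T :=
  Set.image_congr fun j hj => Function.update_of_ne (fun h => hi (by rwa [h] at hj)) _ _

/-- Steinitz exchange: as `v` has a nonzero `i`-th coordinate, `e i` can be recovered from `v` and
the other vectors. -/
theorem Module.Basis.span_image_update {ι K V : Type*} [Field K] [AddCommGroup V] [Module K V]
    [DecidableEq ι] (e : Module.Basis ι K V) {i : ι} {v : V} (hv : e.repr v i ≠ 0) {T : Set ι}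
    (hi : i ∈ T) (hvT : v ∈ Submodule.span K (e '' T)) :
    Submodule.span K (Function.update e i v '' T) = Submodule.span K (e '' T) := by
  apply le_antisymm
  · refine Submodule.span_le.2 ?_
    rintro _ ⟨j, hj, rfl⟩
    by_cases h : j = i
    · subst h; simpa using hvT
    · rw [Function.update_of_ne h]
      exact Submodule.subset_span ⟨j, hj, rfl⟩
  · have hT : T = insert i (T \ {i}) := by simp [Set.insert_eq_of_mem hi]
    have hsub : insert v (e '' (T \ {i})) ⊆ Function.update e i v '' T := by
      rintro _ (rfl | ⟨j, hj, rfl⟩)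
      · exact ⟨i, hi, by simp⟩
      · exact ⟨j, hj.1, Function.update_of_ne hj.2 _ _⟩
    have hei : e i ∈ Submodule.span K (insert v (e '' (T \ {i}))) := by
      refine mem_span_insert_exchange ?_ ?_
      · rwa [← Set.image_insert_eq, ← hT]
      · rw [e.mem_span_image]
        intro h
        have : i ∈ T \ {i} := h (by simpa using hv)
        exact this.2 rfl
    refine Submodule.span_le.2 ?_
    rintro _ ⟨j, hj, rfl⟩
    by_cases h : j = i
    · subst h; exact Submodule.span_mono hsub hei
    · exact Submodule.subset_span ⟨j, hj, Function.update_of_ne h _ _⟩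

/-- A basis simultaneously adapted to the filtration by the grades of a given basis and to the
filtration spanned by a graded finite family of vectors. -/
theorem exists_basis_adapted {ι κ K V : Type*} [Fintype ι] [Field K] [AddCommGroup V]
    [Module K V] (b : Module.Basis ι K V) (g : ι → ℝ) (col : κ → V) (c : κ → ℝ) (s : Finset κ) :
    ∃ (e : Module.Basis ι K V) (τ : ι → Option κ), (∀ i, ∀ j ∈ τ i, j ∈ s) ∧
      (∀ x, Submodule.span K (b '' {i | g i ≤ x}) = Submodule.span K (e '' {i | g i ≤ x})) ∧
      ∀ x, Submodule.span K (col '' {j | j ∈ s ∧ c j ≤ x}) =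
        Submodule.span K (e '' {i | ∃ j, τ i = some j ∧ c j ≤ x}) := by
  classical
  -- Columns are added in increasing order of `c`, so a new column matters only at parameters where
  -- all earlier ones are already present. An index `i` with `τ i = some j` is one whose basis
  -- vector is killed by column `j`.
  induction s using Finset.induction_on_max_value c with
  | empty => exact ⟨b, fun _ => none, by simp, fun _ => rfl, fun x => by simp⟩
  | insert j₀ s hj₀ hmax ih =>
    obtain ⟨e, τ, hτ, hgen, hrel⟩ := ih
    have hlow : ∀ x, ¬ c j₀ ≤ x →
        {j | j ∈ insert j₀ s ∧ c j ≤ x} = {j | j ∈ s ∧ c j ≤ x} := by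
      intro x hx
      ext j
      simp only [Finset.mem_insert, Set.mem_ofPred_eq]
      constructor
      · rintro ⟨rfl | hj, hjx⟩
        exacts [absurd hjx hx, ⟨hj, hjx⟩]
      · rintro ⟨hj, hjx⟩
        exact ⟨Or.inr hj, hjx⟩
    have hhigh : ∀ x, c j₀ ≤ x →
        {j | j ∈ insert j₀ s ∧ c j ≤ x} = insert j₀ {j | j ∈ s ∧ c j ≤ x} := by
      intro x hx
      ext j
      simp only [Finset.mem_insert, Set.mem_ofPred_eq, Set.mem_insert_iff]
      constructor
      · rintro ⟨rfl | hj, hjx⟩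
        exacts [Or.inl rfl, Or.inr ⟨hj, hjx⟩]
      · rintro (rfl | ⟨hj, hjx⟩)
        exacts [⟨Or.inl rfl, hx⟩, ⟨Or.inr hj, hjx⟩]
    have hpaired : ∀ x, c j₀ ≤ x → {i | ∃ j, τ i = some j ∧ c j ≤ x} = {i | τ i ≠ none} := by
      intro x hx
      ext i
      simp only [Set.mem_ofPred_eq, Option.ne_none_iff_exists']
      exact ⟨fun ⟨j, h, _⟩ => ⟨j, h⟩, fun ⟨j, h⟩ => ⟨j, h, (hmax j (hτ i j h)).trans hx⟩⟩
    set R := Submodule.span K (e '' {i | τ i ≠ none}) with hR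
    have hRhigh : ∀ x, c j₀ ≤ x →
        Submodule.span K (col '' {j | j ∈ insert j₀ s ∧ c j ≤ x}) =
          Submodule.span K {col j₀} ⊔ R := by
      intro x hx
      rw [hhigh x hx, Set.image_insert_eq, Submodule.span_insert, hrel, hpaired x hx]
    -- The new column reduced modulo `R`, the span of the basis vectors already killed.
    let v := ∑ i ∈ Finset.univ.filter (fun i => τ i = none), e.repr (col j₀) i • e i
    have hvrepr : ∀ i, e.repr v i = if τ i = none then e.repr (col j₀) i else 0 := by
      intro i
      simp only [v, map_sum, map_smul, Module.Basis.repr_self, Finsupp.coe_finsetSum,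
        Finset.sum_apply, Finsupp.smul_apply, Finsupp.single_apply, smul_eq_mul, mul_ite, mul_one,
        mul_zero, Finset.sum_ite_eq', Finset.mem_filter, Finset.mem_univ, true_and]
    have hdiff : col j₀ - v ∈ R := by
      rw [hR, e.mem_span_image]
      intro i hi hnone
      rw [Finset.mem_coe, Finsupp.mem_support_iff, map_sub, Finsupp.sub_apply, hvrepr,
        if_pos hnone, sub_self] at hi
      exact hi rfl
    have hspan : Submodule.span K {col j₀} ⊔ R = Submodule.span K {v} ⊔ R := by
      apply le_antisymm <;> refine sup_le ?_ le_sup_right <;>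
        rw [Submodule.span_singleton_le_iff_mem]
      · rw [← sub_add_cancel (col j₀) v]
        exact add_mem (Submodule.mem_sup_right hdiff)
          (Submodule.mem_sup_left (Submodule.mem_span_singleton_self v))
      · rw [← sub_sub_self (col j₀) v]
        exact sub_mem (Submodule.mem_sup_left (Submodule.mem_span_singleton_self _))
          (Submodule.mem_sup_right hdiff)
    by_cases hS : ∃ i, τ i = none ∧ e.repr (col j₀) i ≠ 0
    -- The pivot is an unpaired index of greatest grade in the support of `v`. Thus `v` already lies
    -- in the generator filtration at grade `g i₀`, and exchanging `e i₀` for `v` preserves that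
    -- filtration.
    · obtain ⟨i₀, hi₀, hi₀max⟩ :=
        (Finset.univ.filter fun i => τ i = none ∧ e.repr (col j₀) i ≠ 0).exists_max_image g
          (by obtain ⟨i, hi⟩ := hS; exact ⟨i, by simpa using hi⟩)
      simp only [Finset.mem_filter, Finset.mem_univ, true_and] at hi₀ hi₀max
      have hv₀ : e.repr v i₀ ≠ 0 := by rw [hvrepr, if_pos hi₀.1]; exact hi₀.2
      have hvsupp : ∀ i, e.repr v i ≠ 0 → g i ≤ g i₀ := by
        intro i hi
        rw [hvrepr] at hi
        by_cases h : τ i = none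
        · rw [if_pos h] at hi
          exact hi₀max i ⟨h, hi⟩
        · exact absurd (if_neg h) hi
      have htop : ⊤ ≤ Submodule.span K (Set.range (Function.update e i₀ v)) := by
        rw [← Set.image_univ, e.span_image_update hv₀ (Set.mem_univ _), Set.image_univ, e.span_eq]
        rw [Set.image_univ, e.span_eq]
        trivial
      let e' := basisOfTopLeSpanOfCardEqFinrank (Function.update e i₀ v) htop
        (Module.finrank_eq_card_basis e).symm
      have he' : (e' : ι → V) = Function.update e i₀ v :=
        coe_basisOfTopLeSpanOfCardEqFinrank _ _ _
      refine ⟨e', Function.update τ i₀ (some j₀), ?_, fun x => ?_, fun x => ?_⟩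
      · intro i j hj
        by_cases hi : i = i₀
        · subst hi
          rw [Function.update_self] at hj
          rw [← Option.some_inj.1 hj]
          exact Finset.mem_insert_self _ _
        · rw [Function.update_of_ne hi] at hj
          exact Finset.mem_insert_of_mem (hτ i j hj)
      · rw [hgen, he']
        by_cases hx : g i₀ ≤ x
        · refine (e.span_image_update hv₀ hx ?_).symm
          rw [e.mem_span_image]
          intro i hi
          exact (hvsupp i (by simpa using hi)).trans hx
        · rw [span_image_update_of_notMem (K := K) (⇑e) v hx]
      · rw [he']
        have hnot : ∀ x, i₀ ∉ {i | ∃ j, τ i = some j ∧ c j ≤ x} := by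
          rintro x ⟨j, hj, _⟩
          rw [hi₀.1] at hj
          cases hj
        by_cases hx : c j₀ ≤ x
        · have hset : {i | ∃ j, Function.update τ i₀ (some j₀) i = some j ∧ c j ≤ x} =
              insert i₀ {i | ∃ j, τ i = some j ∧ c j ≤ x} := by
            ext i
            by_cases hi : i = i₀
            · subst hi; simp [hx]
            · simp [hi]
          rw [hset, Set.image_insert_eq, span_image_update_of_notMem (K := K) (⇑e) v (hnot x),
            Function.update_self, Submodule.span_insert, hRhigh x hx, hspan, hpaired x hx]
        · have hset : {i | ∃ j, Function.update τ i₀ (some j₀) i = some j ∧ c j ≤ x} =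
              {i | ∃ j, τ i = some j ∧ c j ≤ x} := by
            ext i
            by_cases hi : i = i₀
            · subst hi; simp [hx, hi₀.1]
            · simp [Function.update_of_ne hi]
          rw [hset, hlow x hx, hrel, span_image_update_of_notMem (K := K) (⇑e) v (hnot x)]
    -- The new column depends on the earlier ones and kills nothing.
    · have hv : v = 0 := Finset.sum_eq_zero fun i hi => by
        have hi := (Finset.mem_filter.1 hi).2
        by_contra hne
        exact hS ⟨i, hi, fun h => hne (by rw [h, zero_smul])⟩
      refine ⟨e, τ, fun i j hj => Finset.mem_insert_of_mem (hτ i j hj), hgen, fun x => ?_⟩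
      by_cases hx : c j₀ ≤ x
      · rw [hRhigh x hx, hspan, hpaired x hx, hv]
        simp [hR]
      · rw [hlow x hx, hrel]

namespace FinitePresentation

variable {K : Type u} [Field K] {X : Type w} [Preorder X]

/-- The column `j` as a vector. -/
def col (P : FinitePresentation K X) (j : Fin P.numCols) : Fin P.numRows → K := fun i => P.mat i j

/-- `e` and `τ` describe the generators and relations at `x`: they are spanned by the `e i` with
`i` of grade at most `x`, respectively with `i` paired with a column of grade at most `x`. -/
def Adapted (P : FinitePresentation K X) (e : Module.Basis (Fin P.numRows) K (Fin P.numRows → K))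
    (τ : Fin P.numRows → Option (Fin P.numCols)) (x : X) : Prop :=
  P.gen x = Submodule.span K (e '' {i | P.rowGrade i ≤ x}) ∧
    P.rel x = Submodule.span K (e '' {i | ∃ j, τ i = some j ∧ P.colGrade j ≤ x})

theorem gen_eq (P : FinitePresentation K X) (x : X) :
    P.gen x = Submodule.span K (Pi.basisFun K (Fin P.numRows) '' {i | P.rowGrade i ≤ x}) := by
  rw [gen]
  congr 1
  ext v
  simp [eq_comm]

theorem rel_eq (P : FinitePresentation K X) (x : X) :
    P.rel x = Submodule.span K (P.col '' {j | P.colGrade j ≤ x}) := by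
  rw [rel]
  congr 1
  ext v
  simp only [Set.mem_image, Set.mem_ofPred_eq]
  exact exists_congr fun j => and_congr_right fun _ => eq_comm

theorem exists_adapted (P : FinitePresentation K X) (f : ℝ → X) (b : Fin P.numRows → ℝ)
    (c : Fin P.numCols → ℝ) (hb : ∀ i y, P.rowGrade i ≤ f y ↔ b i ≤ y)
    (hc : ∀ j y, P.colGrade j ≤ f y ↔ c j ≤ y) : ∃ e τ, ∀ y, P.Adapted e τ (f y) := by
  obtain ⟨e, τ, -, hgen, hrel⟩ :=
    exists_basis_adapted (Pi.basisFun K (Fin P.numRows)) b P.col c Finset.univ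
  refine ⟨e, τ, fun y => ⟨?_, ?_⟩⟩
  · simp only [gen_eq, hb]
    exact hgen y
  · simp only [rel_eq, hc]
    simpa using hrel y

/-- Adaptedness at a point depends only on which grades lie below it, so one basis can serve many
slices. -/
theorem Adapted.congr {P : FinitePresentation K X}
    {e : Module.Basis (Fin P.numRows) K (Fin P.numRows → K)}
    {τ : Fin P.numRows → Option (Fin P.numCols)} {x x' : X} (h : P.Adapted e τ x)
    (hr : ∀ i, P.rowGrade i ≤ x' ↔ P.rowGrade i ≤ x)
    (hc : ∀ j, P.colGrade j ≤ x' ↔ P.colGrade j ≤ x) : P.Adapted e τ x' := by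
  obtain ⟨h1, h2⟩ := h
  rw [gen_eq] at h1
  rw [rel_eq] at h2
  constructor
  · simp only [gen_eq, hr, h1]
  · simp only [rel_eq, hc, h2]

/-- A simultaneously adapted basis yields an interval decomposition. -/
theorem isDiagram_of_adapted (P : FinitePresentation K X) (f : ℝ →o X) (b : Fin P.numRows → ℝ)
    (c : Fin P.numCols → ℝ) (hb : ∀ i y, P.rowGrade i ≤ f y ↔ b i ≤ y)
    (hc : ∀ j y, P.colGrade j ≤ f y ↔ c j ≤ y)
    (e : Module.Basis (Fin P.numRows) K (Fin P.numRows → K))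
    (τ : Fin P.numRows → Option (Fin P.numCols)) (h : ∀ y, P.Adapted e τ (f y))
    (d : Fin P.numRows → WithTop ℝ) (hd : ∀ i, d i = (τ i).elim ⊤ fun j => (c j : WithTop ℝ))
    {n : ℕ} (ρ : Fin n → Fin P.numRows) (hρ : Function.Injective ρ)
    (hlt : ∀ i, (b i : WithTop ℝ) < d i ↔ i ∈ Set.range ρ) :
    (P.toModule.pullback f).IsDiagram
      ⟨n, fun i => b (ρ i), fun i => d (ρ i), fun i => (hlt _).2 ⟨i, rfl⟩⟩ := by
  classical
  set D : PersistenceDiagram :=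
    ⟨n, fun i => b (ρ i), fun i => d (ρ i), fun i => (hlt _).2 ⟨i, rfl⟩⟩ with hD
  have hgen : ∀ y v, v ∈ P.gen (f y) ↔ ∀ i, e.repr v i ≠ 0 → b i ≤ y := by
    intro y v
    rw [(h y).1, e.mem_span_image]
    simp only [hb]
    exact ⟨fun H i hi => H (by simpa using hi), fun H i hi => H i (by simpa using hi)⟩
  have hdle : ∀ i y, (∃ j, τ i = some j ∧ c j ≤ y) ↔ ¬ ((y : ℝ) : WithTop ℝ) < d i := by
    intro i y
    rw [hd, not_lt]
    cases τ i <;> simp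
  have hrel : ∀ y v, v ∈ P.rel (f y) ↔ ∀ i, e.repr v i ≠ 0 → ¬ ((y : ℝ) : WithTop ℝ) < d i := by
    intro y v
    rw [(h y).2, e.mem_span_image]
    simp only [hc, hdle]
    exact ⟨fun H i hi => H (by simpa using hi), fun H i hi => H i (by simpa using hi)⟩
  -- `Ψ` reads off the coordinates alive at `y`. Its kernel is exactly the relations: a generator at
  -- `y` with a nonzero coordinate that is not yet dead has its birth at most `y`, so this index is
  -- in the range of `ρ`.
  let Ψ : ∀ y : ℝ, P.gen (f y) →ₗ[K] (D.toModule K).obj y := fun y =>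
    LinearMap.pi fun i => LinearMap.pi fun _ => e.coord (ρ i) ∘ₗ (P.gen (f y)).subtype
  have hΨ : ∀ y a i u, Ψ y a i u = e.repr a (ρ i) := fun y a i u => rfl
  have hker : ∀ y, (P.rel (f y)).submoduleOf (P.gen (f y)) = LinearMap.ker (Ψ y) := by
    intro y
    ext ⟨a, ha⟩
    rw [LinearMap.mem_ker]
    refine Iff.trans (hrel y a) ?_
    constructor
    · intro H
      funext i u
      rw [hΨ]
      by_contra hne
      exact H _ hne u.down.2
    · intro H i hi hy
      have hbi := (hgen y a).1 ha i hi
      obtain ⟨k, rfl⟩ := (hlt i).1 ((WithTop.coe_le_coe.2 hbi).trans_lt hy)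
      have := congrFun (congrFun H k) (PLift.up ⟨hbi, hy⟩)
      rw [hΨ] at this
      exact hi this
  have hsurj : ∀ y, Function.Surjective (Ψ y) := by
    intro y a
    let v : Fin P.numRows → K := ∑ k : Fin n,
      (if hk : b (ρ k) ≤ y ∧ (y : WithTop ℝ) < d (ρ k) then a k (PLift.up hk) else 0) • e (ρ k)
    have hv : ∀ i, e.repr v i = ∑ k : Fin n,
        if ρ k = i then
          (if hk : b (ρ k) ≤ y ∧ (y : WithTop ℝ) < d (ρ k) then a k (PLift.up hk) else 0)
        else 0 := by
      intro i
      simp only [v, map_sum, map_smul, Module.Basis.repr_self, Finsupp.coe_finsetSum,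
        Finset.sum_apply, Finsupp.smul_apply, Finsupp.single_apply, smul_eq_mul, mul_ite, mul_one,
        mul_zero]
    have hvgen : v ∈ P.gen (f y) := by
      rw [hgen]
      intro i hi
      rw [hv] at hi
      obtain ⟨k, -, hk⟩ := Finset.exists_ne_zero_of_sum_ne_zero hi
      by_contra hne
      refine hk ?_
      split_ifs with h1 h2
      · exact absurd (h1 ▸ h2.1) hne
      · rfl
      · rfl
    refine ⟨⟨v, hvgen⟩, ?_⟩
    funext i u
    rw [hΨ, hv]
    simp only [hρ.eq_iff, Finset.sum_ite_eq', Finset.mem_univ, if_true]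
    exact dif_pos u.down
  let E : ∀ y, (P.toModule.pullback f).obj y ≃ₗ[K] (D.toModule K).obj y := fun y =>
    (Submodule.quotEquivOfEq _ _ (hker y)).trans ((Ψ y).quotKerEquivOfSurjective (hsurj y))
  have hE : ∀ y (a : P.gen (f y)), E y (Submodule.Quotient.mk a) = Ψ y a := fun y a => rfl
  refine ⟨⟨E, fun {x y} hxy a => ?_⟩⟩
  obtain ⟨a, rfl⟩ := Submodule.Quotient.mk_surjective _ a
  have hmap : (P.toModule.pullback f).map hxy (Submodule.Quotient.mk a) =
      Submodule.Quotient.mk (Submodule.inclusion (P.gen_mono (f.monotone hxy)) a) := rfl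
  rw [hmap, hE, hE]
  funext i u
  rw [hΨ]
  have hR : (D.toModule K).map hxy (Ψ x a) i u =
      (if hi : b (ρ i) ≤ x ∧ (x : WithTop ℝ) < d (ρ i) then
        (LinearMap.proj (PLift.up hi) :
          (PLift (b (ρ i) ≤ x ∧ (x : WithTop ℝ) < d (ρ i)) → K) →ₗ[K] K) else 0) (Ψ x a i) := rfl
  rw [hR]
  split_ifs with hi
  · rfl
  · by_contra hne
    exact hi ⟨(hgen x a).1 a.2 _ hne,
      (WithTop.coe_le_coe.2 hxy).trans_lt u.down.2⟩

end FinitePresentation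

/-! ## Diagrams of slices -/

namespace Slice

/-- The parameter at which the slice enters the quadrant above `p`. -/
noncomputable def push (l : Slice) (p : ℝ × ℝ) : ℝ :=
  max p.1 ((p.2 - l.t) / l.s) * √(1 + l.s ^ 2)

/-- Turns the two-parameter grading into a real grading along the slice, so that the one-parameter
decomposition applies. -/
theorem le_param_iff (l : Slice) (p : ℝ × ℝ) (y : ℝ) : p ≤ l.param y ↔ l.push p ≤ y := by
  have hs := l.s_pos
  have hr : 0 < √(1 + l.s ^ 2) := Real.sqrt_pos.2 (by positivity)
  change p.1 ≤ y / √(1 + l.s ^ 2) ∧ p.2 ≤ l.s * (y / √(1 + l.s ^ 2)) + l.t ↔ _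
  rw [push, ← le_div_iff₀ hr, max_le_iff, div_le_iff₀ hs, sub_le_iff_le_add, mul_comm l.s]

theorem weight_pos (l : Slice) : 0 < l.weight := by
  have hs := l.s_pos
  unfold weight
  split_ifs <;> positivity

/-- The weighted parameter at which the slice enters the quadrant above `p`. -/
noncomputable def weightedPush (l : Slice) (p : ℝ × ℝ) : ℝ := l.weight * l.push p

/-- The weight is the inverse of the square root in `push`; what remains is a maximum of affine
functions of `1 / l.s` and `l.t / l.s`. -/
theorem weightedPush_of_one_le (l : Slice) (h : 1 ≤ l.s) (p : ℝ × ℝ) :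
    l.weightedPush p = max p.1 (1 / l.s * p.2 - l.t / l.s) := by
  have hr : √(1 + l.s ^ 2) ≠ 0 := (Real.sqrt_pos.2 (by positivity)).ne'
  rw [weightedPush, weight, if_pos h, push, one_div, mul_comm, mul_assoc, mul_inv_cancel₀ hr,
    mul_one]
  congr 1
  ring

/-- Here the weight equals `l.s / √(1 + l.s ^ 2)`, and the natural coordinates are `l.s` and `l.t`.
-/
theorem weightedPush_of_lt_one (l : Slice) (h : l.s < 1) (p : ℝ × ℝ) :
    l.weightedPush p = max (l.s * p.1) (p.2 - l.t) := by
  have hs := l.s_pos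
  have hr : √(1 + l.s ^ 2) ≠ 0 := (Real.sqrt_pos.2 (by positivity)).ne'
  have h1 : √(1 + 1 / l.s ^ 2) = √(1 + l.s ^ 2) / l.s := by
    rw [show 1 + 1 / l.s ^ 2 = (1 + l.s ^ 2) / l.s ^ 2 by field_simp; ring,
      Real.sqrt_div (by positivity), Real.sqrt_sq hs.le]
  rw [weightedPush, weight, if_neg h.not_ge, push, h1, one_div_div, mul_comm, mul_assoc,
    mul_div_cancel₀ _ hr, mul_comm, mul_max_of_nonneg _ _ hs.le, mul_div_cancel₀ _ hs.ne']

/-- In both formulas the coordinates of the bigrade carry coefficients in `(0, 1]`, and the maximum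
is 1-Lipschitz for the sup distance. The bound is uniform in the slice. -/
theorem abs_weightedPush_sub_le (l : Slice) (p q : ℝ × ℝ) :
    |l.weightedPush p - l.weightedPush q| ≤ dist p q := by
  have hs := l.s_pos
  have h1 : |p.1 - q.1| ≤ dist p q := le_max_left _ _
  have h2 : |p.2 - q.2| ≤ dist p q := le_max_right _ _
  rcases le_or_gt 1 l.s with h | h
  · rw [l.weightedPush_of_one_le h, l.weightedPush_of_one_le h]
    refine (abs_max_sub_max_le_max _ _ _ _).trans (max_le h1 ?_)
    rw [sub_sub_sub_cancel_right, ← mul_sub, abs_mul, abs_of_pos (by positivity)]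
    refine le_trans (mul_le_of_le_one_left (abs_nonneg _) ?_) h2
    rwa [div_le_one hs]
  · rw [l.weightedPush_of_lt_one h, l.weightedPush_of_lt_one h]
    refine (abs_max_sub_max_le_max _ _ _ _).trans (max_le ?_ ?_)
    · rw [← mul_sub, abs_mul, abs_of_pos hs]
      exact le_trans (mul_le_of_le_one_left (abs_nonneg _) h.le) h1
    · rwa [sub_sub_sub_cancel_right]

end Slice

/-- A family of pairs of bigrades, the second of which may be `∞`. -/
structure BigradedDiagram where
  size : ℕ
  birth : Fin size → ℝ × ℝ
  death : Fin size → Option (ℝ × ℝ)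

namespace BigradedDiagram

/-- All bigrades in the family belong to `G`. -/
def GradesIn (D : BigradedDiagram) (G : Set (ℝ × ℝ)) : Prop :=
  (∀ i, D.birth i ∈ G) ∧ ∀ i, ∀ p ∈ D.death i, p ∈ G

/-- The real or infinite image of a possibly infinite bigrade. -/
def evalDeath (φ : ℝ × ℝ → ℝ) (d : Option (ℝ × ℝ)) : WithTop ℝ := d.elim ⊤ fun p => (φ p : WithTop ℝ)

/-- The persistence diagram obtained by evaluating a function at the bigrades. -/
def realize (D : BigradedDiagram) (φ : ℝ × ℝ → ℝ)
    (h : ∀ i, (φ (D.birth i) : WithTop ℝ) < evalDeath φ (D.death i)) : PersistenceDiagram :=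
  ⟨D.size, fun i => φ (D.birth i), fun i => evalDeath φ (D.death i), h⟩

/-- The number of points at infinity. -/
def numInfinite (D : BigradedDiagram) : ℕ := Fintype.card {i // D.death i = none}

end BigradedDiagram

/-- Two functions on a finite type that induce the same preorder have the same lower cuts. -/
theorem exists_cut_iff {ι : Type*} [Finite ι] (f f' : ι → ℝ)
    (h : ∀ i j, f i ≤ f j ↔ f' i ≤ f' j) (y' : ℝ) : ∃ y, ∀ i, f' i ≤ y' ↔ f i ≤ y := by
  by_cases hne : {i | f' i ≤ y'}.Nonempty
  · obtain ⟨i₀, hi₀, hmax⟩ := Set.exists_max_image _ f' (Set.toFinite {i | f' i ≤ y'}) hne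
    refine ⟨f i₀, fun i => ?_⟩
    rw [h]
    exact ⟨fun hi => hmax i hi, fun hi => le_trans hi hi₀⟩
  · obtain ⟨m, hm⟩ := (Set.finite_range f).bddBelow
    refine ⟨m - 1, fun i => iff_of_false (fun hi => hne ⟨i, hi⟩) fun hi => ?_⟩
    have := hm ⟨i, rfl⟩
    linarith

namespace FinitePresentation

variable {K : Type u} [Field K]

/-- The grades of the rows and columns. -/
def grade {X : Type w} [Preorder X] (P : FinitePresentation K X) :
    Fin P.numRows ⊕ Fin P.numCols → X :=
  Sum.elim P.rowGrade P.colGrade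

/-- Along slices that induce the same preorder of the grades, the persistence diagrams are given
by the same pairs of bigrades. -/
theorem exists_bigradedDiagram (P : FinitePresentation K (ℝ × ℝ))
    (r : Fin P.numRows ⊕ Fin P.numCols → Fin P.numRows ⊕ Fin P.numCols → Prop) :
    ∃ D : BigradedDiagram, D.GradesIn (Set.range P.grade) ∧
      ∀ l : Slice, (∀ i j, l.push (P.grade i) ≤ l.push (P.grade j) ↔ r i j) →
        D.numInfinite + Module.finrank K (Submodule.span K (Set.range P.col)) = P.numRows ∧
        ∃ h, (P.toModule.slice l).IsDiagram (D.realize l.push h) := by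
  classical
  by_cases hr : ∃ l : Slice, ∀ i j, l.push (P.grade i) ≤ l.push (P.grade j) ↔ r i j
  swap
  -- No slice induces `r`, so any family will do.
  · exact ⟨⟨0, Fin.elim0, Fin.elim0⟩, ⟨fun i => i.elim0, fun i => i.elim0⟩,
      fun l hl => absurd ⟨l, hl⟩ hr⟩
  obtain ⟨l₀, hl₀⟩ := hr
  obtain ⟨e, τ, had⟩ := P.exists_adapted l₀.param (fun i => l₀.push (P.rowGrade i))
    (fun j => l₀.push (P.colGrade j)) (fun i y => l₀.le_param_iff _ y)
    fun j y => l₀.le_param_iff _ y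
  let d : Fin P.numRows → Option (ℝ × ℝ) := fun i => (τ i).map P.colGrade
  -- Indices whose birth does not precede their death give no interval. The condition compares
  -- pushes of grades, so it selects the same indices on every slice inducing `r`.
  let S := {i : Fin P.numRows // (l₀.push (P.rowGrade i) : WithTop ℝ) <
    BigradedDiagram.evalDeath l₀.push (d i)}
  let ρ : Fin (Fintype.card S) → Fin P.numRows := fun k => ((Fintype.equivFin S).symm k).1
  have hρ : Function.Injective ρ := Subtype.val_injective.comp (Equiv.injective _)
  have hrange : ∀ i, i ∈ Set.range ρ ↔ (l₀.push (P.rowGrade i) : WithTop ℝ) <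
      BigradedDiagram.evalDeath l₀.push (d i) := by
    intro i
    constructor
    · rintro ⟨k, rfl⟩
      exact ((Fintype.equivFin S).symm k).2
    · exact fun hi => ⟨Fintype.equivFin S ⟨i, hi⟩, by simp [ρ]⟩
  refine ⟨⟨Fintype.card S, fun k => P.rowGrade (ρ k), fun k => d (ρ k)⟩, ⟨?_, ?_⟩, fun l hl => ?_⟩
  · exact fun k => ⟨Sum.inl (ρ k), rfl⟩
  · intro k p hp
    obtain ⟨j, -, rfl⟩ := Option.map_eq_some_iff.1 hp
    exact ⟨Sum.inr j, rfl⟩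
  have hll : ∀ i j, l₀.push (P.grade i) ≤ l₀.push (P.grade j) ↔
      l.push (P.grade i) ≤ l.push (P.grade j) := fun i j => (hl₀ i j).trans (hl i j).symm
  have hadl : ∀ y, P.Adapted e τ (l.param y) := by
    intro y
    -- Each point of `l` lies above the same grades as some point of `l₀`, where the basis is known
    -- to be adapted.
    obtain ⟨y₀, hy₀⟩ := exists_cut_iff (fun i => l₀.push (P.grade i))
      (fun i => l.push (P.grade i)) hll y
    refine (had y₀).congr (fun i => ?_) fun j => ?_
    · rw [l.le_param_iff, l₀.le_param_iff]
      exact hy₀ (Sum.inl i)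
    · rw [l.le_param_iff, l₀.le_param_iff]
      exact hy₀ (Sum.inr j)
  have hlt : ∀ i, (l.push (P.rowGrade i) : WithTop ℝ) < BigradedDiagram.evalDeath l.push (d i) ↔
      i ∈ Set.range ρ := by
    intro i
    rw [hrange]
    simp only [d, BigradedDiagram.evalDeath]
    cases τ i with
    | none => simp
    | some j =>
      simp only [Option.map_some, Option.elim_some, WithTop.coe_lt_coe]
      rw [← not_le, ← not_le]
      exact not_congr (hll (Sum.inr j) (Sum.inl i)).symm
  refine ⟨?_, _, P.isDiagram_of_adapted l.param (fun i => l.push (P.rowGrade i))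
    (fun j => l.push (P.colGrade j)) (fun i y => l.le_param_iff _ y)
    (fun j y => l.le_param_iff _ y) e τ hadl _ (fun i => ?_) ρ hρ hlt⟩
  -- Far along the slice all relations are present, so the rank of the matrix counts the paired
  -- indices; the unpaired ones are the points at infinity.
  · obtain ⟨m, hm⟩ := (Set.finite_range fun j => l.push (P.colGrade j)).bddAbove
    have hmj : ∀ j, P.colGrade j ≤ l.param m := fun j => (l.le_param_iff _ _).2 (hm ⟨j, rfl⟩)
    have h2 := (hadl m).2
    rw [rel_eq] at h2
    have h3 : {j | P.colGrade j ≤ l.param m} = Set.univ := Set.eq_univ_of_forall hmj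
    have h4 : {i | ∃ j, τ i = some j ∧ P.colGrade j ≤ l.param m} = {i | τ i ≠ none} := by
      ext i
      simp only [Set.mem_ofPred_eq, Option.ne_none_iff_exists', hmj, and_true]
    rw [h3, Set.image_univ, h4] at h2
    have h5 : Module.finrank K (Submodule.span K (Set.range P.col)) =
        Fintype.card {i // τ i ≠ none} := by
      rw [h2, ← Subtype.range_coe (s := {i | τ i ≠ none}), ← Set.range_comp]
      exact finrank_span_eq_card (e.linearIndependent.comp _ Subtype.val_injective)
    have h6 : BigradedDiagram.numInfinite
        ⟨Fintype.card S, fun k => P.rowGrade (ρ k), fun k => d (ρ k)⟩ =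
        Fintype.card {i // τ i = none} := by
      refine Fintype.card_of_bijective (f := fun k => ⟨ρ k.1, Option.map_eq_none_iff.1 k.2⟩)
        ⟨fun k k' h => Subtype.ext (@hρ k.1 k'.1 (Subtype.mk.inj h)), fun i => ?_⟩
      obtain ⟨k, hk⟩ := (hrange i.1).2 (by simp [d, i.2, BigradedDiagram.evalDeath])
      exact ⟨⟨k, by simp [hk, d, i.2]⟩, Subtype.ext hk⟩
    rw [h5, h6, Fintype.card_subtype_compl, Fintype.card_fin]
    have := Fintype.card_subtype_le fun i => τ i = none
    rw [Fintype.card_fin] at this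
    omega
  · simp only [d, BigradedDiagram.evalDeath]
    cases τ i <;> rfl

end FinitePresentation

/-! ## Weighted bottleneck distances as semilinear conditions -/

/-- The assumption `⊥ < a` is what handles an empty index type. -/
theorem le_iSup_iff_exists_of_finite {α : Type*} {ι : Sort*} [CompleteLinearOrder α] [Finite ι]
    {a : α} (ha : ⊥ < a) (f : ι → α) : a ≤ ⨆ i, f i ↔ ∃ i, a ≤ f i := by
  refine ⟨fun h => ?_, fun ⟨i, hi⟩ => hi.trans (le_iSup f i)⟩
  rcases isEmpty_or_nonempty ι with hι | hι
  · rw [iSup_of_empty] at h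
    exact absurd h ha.not_ge
  · obtain ⟨i, hi⟩ := (Set.range_nonempty f).csSup_mem (Set.finite_range f)
    exact ⟨i, hi ▸ h⟩

namespace PersistenceDiagram

theorem le_cost_iff (D E : PersistenceDiagram) (σ : Fin D.size ≃. Fin E.size) {a : ℝ}
    (ha : 0 < a) : ENNReal.ofReal a ≤ cost D E σ ↔
      (∃ i j, σ i = some j ∧ (a ≤ |D.birth i - E.birth j| ∨
        ENNReal.ofReal a ≤ deathDist (D.death i) (E.death j))) ∨
      (∃ i, σ i = none ∧ ENNReal.ofReal a ≤ halfLength (D.birth i) (D.death i)) ∨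
      ∃ j, σ.symm j = none ∧ ENNReal.ofReal a ≤ halfLength (E.birth j) (E.death j) := by
  have ha' : ⊥ < ENNReal.ofReal a := ENNReal.ofReal_pos.2 ha
  simp only [cost, le_sup_iff, le_iSup_iff_exists_of_finite ha', exists_prop,
    ENNReal.ofReal_le_ofReal_iff (abs_nonneg _)]

end PersistenceDiagram

namespace BigradedDiagram

/-- `v` is at most the distance of two possibly infinite bigrades, evaluated with `φ`. -/
def LeDeathDist (φ : ℝ × ℝ → ℝ) (v : ℝ) : Option (ℝ × ℝ) → Option (ℝ × ℝ) → Prop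
  | some p, some q => v ≤ |φ p - φ q|
  | none, none => False
  | some _, none => True
  | none, some _ => True

/-- `v` is at most the half length of the interval given by two bigrades, evaluated with `φ`. -/
def LeHalfLength (φ : ℝ × ℝ → ℝ) (v : ℝ) (p : ℝ × ℝ) : Option (ℝ × ℝ) → Prop
  | some q => v ≤ (φ q - φ p) / 2
  | none => True

/-- `v` is at most the cost of a partial matching, evaluated with `φ`. -/
def LeCost (D E : BigradedDiagram) (σ : Fin D.size ≃. Fin E.size) (φ : ℝ × ℝ → ℝ) (v : ℝ) : Prop :=
  (∃ i j, σ i = some j ∧ (v ≤ |φ (D.birth i) - φ (E.birth j)| ∨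
    LeDeathDist φ v (D.death i) (E.death j))) ∨
  (∃ i, σ i = none ∧ LeHalfLength φ v (D.birth i) (D.death i)) ∨
  ∃ j, σ.symm j = none ∧ LeHalfLength φ v (E.birth j) (E.death j)

/-- `v` is nonpositive or at most the bottleneck distance, evaluated with `φ`. -/
def LeBottleneck (D E : BigradedDiagram) (φ : ℝ × ℝ → ℝ) (v : ℝ) : Prop :=
  v ≤ 0 ∨ ∀ σ : Fin D.size ≃. Fin E.size, LeCost D E σ φ v

theorem div_le_deathDist_iff {w v : ℝ} (hw : 0 < w) (hv : 0 < v) (φ : ℝ × ℝ → ℝ)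
    (d d' : Option (ℝ × ℝ)) :
    ENNReal.ofReal (v / w) ≤ PersistenceDiagram.deathDist (evalDeath φ d) (evalDeath φ d') ↔
      LeDeathDist (fun p => w * φ p) v d d' := by
  have hvw : 0 < v / w := div_pos hv hw
  rcases d with _ | p <;> rcases d' with _ | q
  · change ENNReal.ofReal (v / w) ≤ 0 ↔ False
    simpa using hvw
  · change ENNReal.ofReal (v / w) ≤ ∞ ↔ True
    simp
  · change ENNReal.ofReal (v / w) ≤ ∞ ↔ True
    simp
  · change ENNReal.ofReal (v / w) ≤ ENNReal.ofReal |φ p - φ q| ↔ v ≤ |w * φ p - w * φ q|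
    rw [ENNReal.ofReal_le_ofReal_iff (abs_nonneg _), ← mul_sub, abs_mul, abs_of_pos hw,
      div_le_iff₀ hw, mul_comm]

theorem div_le_halfLength_iff {w v : ℝ} (hw : 0 < w) (hv : 0 < v) (φ : ℝ × ℝ → ℝ)
    (p : ℝ × ℝ) (d : Option (ℝ × ℝ)) :
    ENNReal.ofReal (v / w) ≤ PersistenceDiagram.halfLength (φ p) (evalDeath φ d) ↔
      LeHalfLength (fun p => w * φ p) v p d := by
  have hvw : 0 < v / w := div_pos hv hw
  rcases d with _ | q
  · change ENNReal.ofReal (v / w) ≤ ∞ ↔ True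
    simp
  · change ENNReal.ofReal (v / w) ≤ ENNReal.ofReal ((φ q - φ p) / 2) ↔
      v ≤ (w * φ q - w * φ p) / 2
    rw [ENNReal.ofReal_le_ofReal_iff', or_iff_left hvw.not_ge, ← mul_sub, mul_div_assoc,
      div_le_iff₀ hw, mul_comm]

instance {α β : Type*} [Finite α] [Finite β] : Finite (α ≃. β) :=
  Finite.of_injective (fun σ : α ≃. β => (σ : α → Option β)) DFunLike.coe_injective

/-- All costs are homogeneous, so a positive weight can be moved inside onto the values of `φ`. For
a slice this produces `weightedPush`. -/
theorem ofReal_le_mul_bottleneckDist_iff (D E : BigradedDiagram) {w : ℝ} (hw : 0 < w)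
    (φ : ℝ × ℝ → ℝ) (hD : ∀ i, (φ (D.birth i) : WithTop ℝ) < evalDeath φ (D.death i))
    (hE : ∀ i, (φ (E.birth i) : WithTop ℝ) < evalDeath φ (E.death i)) (v : ℝ) :
    ENNReal.ofReal v ≤ ENNReal.ofReal w *
        PersistenceDiagram.bottleneckDist (D.realize φ hD) (E.realize φ hE) ↔
      LeBottleneck D E (fun p => w * φ p) v := by
  rcases le_or_gt v 0 with hv | hv
  · simp [LeBottleneck, hv, ENNReal.ofReal_of_nonpos hv]
  rw [LeBottleneck, or_iff_right hv.not_ge, ← ENNReal.div_le_iff' (by simpa using hw) (by simp),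
    ← ENNReal.ofReal_div_of_pos hw, PersistenceDiagram.bottleneckDist, le_iInf_iff]
  refine forall_congr' fun σ => ?_
  rw [PersistenceDiagram.le_cost_iff _ _ _ (div_pos hv hw)]
  unfold LeCost
  simp only [realize, div_le_deathDist_iff hw hv, div_le_halfLength_iff hw hv]
  simp only [← mul_sub, abs_mul, abs_of_pos hw, div_le_iff₀' hw]
  exact Iff.rfl

/-- Diagrams with different numbers of points at infinity have infinite distance. -/
theorem leBottleneck_of_numInfinite_ne {D E : BigradedDiagram}
    (h : D.numInfinite ≠ E.numInfinite) (φ : ℝ × ℝ → ℝ) (v : ℝ) : LeBottleneck D E φ v := by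
  refine Or.inr fun σ => ?_
  by_contra hσ
  simp only [LeCost, not_or, not_exists, not_and] at hσ
  obtain ⟨h1, h2, h3⟩ := hσ
  -- A cost below `v` forces infinite points to be matched with infinite points, in both directions;
  -- this gives a bijection between them.
  have hsome : ∀ i, D.death i = none → ∃ j, σ i = some j ∧ E.death j = none := by
    intro i hi
    cases hs : σ i with
    | none => exact absurd (by rw [hi]; trivial) (h2 i hs)
    | some j =>
      refine ⟨j, rfl, ?_⟩
      have := (h1 i j hs).2
      cases hd : E.death j with
      | none => rfl
      | some q => exact absurd (by rw [hi, hd]; trivial) this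
  have hsome' : ∀ j, E.death j = none → ∃ i, σ i = some j ∧ D.death i = none := by
    intro j hj
    cases hs : σ.symm j with
    | none => exact absurd (by rw [hj]; trivial) (h3 j hs)
    | some i =>
      have hs' : σ i = some j := (PEquiv.eq_some_iff σ).1 hs
      refine ⟨i, hs', ?_⟩
      have := (h1 i j hs').2
      cases hd : D.death i with
      | none => rfl
      | some q => exact absurd (by rw [hj, hd]; trivial) this
  choose f hf using hsome
  refine h (Fintype.card_of_bijective (f := fun i : {i // D.death i = none} =>
    (⟨f i.1 i.2, (hf i.1 i.2).2⟩ : {j // E.death j = none})) ⟨fun i i' hii => ?_, fun j => ?_⟩)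
  · have hii' : f i.1 i.2 = f i'.1 i'.2 := congrArg Subtype.val hii
    have h1 := (hf i.1 i.2).1
    rw [hii'] at h1
    exact Subtype.ext (σ.inj h1 (hf i'.1 i'.2).1)
  · obtain ⟨i, hi, hd⟩ := hsome' j.1 j.2
    refine ⟨⟨i, hd⟩, Subtype.ext ?_⟩
    have h1 := (hf i hd).1
    rw [hi] at h1
    exact (Option.some_inj.1 h1).symm

/-- Diagrams with the same number of points at infinity have bounded distance. -/
theorem le_of_leBottleneck {D E : BigradedDiagram} (h : D.numInfinite = E.numInfinite)
    {φ : ℝ × ℝ → ℝ} {G : Set (ℝ × ℝ)} (hD : D.GradesIn G) (hE : E.GradesIn G) {B : ℝ}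
    (hB0 : 0 ≤ B) (hB : ∀ p ∈ G, ∀ q ∈ G, |φ p - φ q| ≤ B) {v : ℝ}
    (hv : LeBottleneck D E φ v) : v ≤ B := by
  classical
  rcases hv with hv | hv
  · exact hv.trans hB0
  let e : {i // D.death i = none} ≃ {j // E.death j = none} := Fintype.equivOfCardEq h
  -- Match the infinite points by any bijection and leave all finite points unmatched. Each cost is
  -- then a difference of two values of `φ` on `G`, or half of one.
  let σ : Fin D.size ≃. Fin E.size :=
    { toFun := fun i => if hi : D.death i = none then some (e ⟨i, hi⟩).1 else none
      invFun := fun j => if hj : E.death j = none then some (e.symm ⟨j, hj⟩).1 else none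
      inv := by
        intro i j
        by_cases hi : D.death i = none <;> by_cases hj : E.death j = none
        · simp only [hi, hj, dif_pos]
          constructor
          · intro hs
            obtain rfl := Option.some_inj.1 hs
            simp
          · intro hs
            obtain rfl := Option.some_inj.1 hs
            simp
        · simp only [hi, hj, dif_pos, dif_neg, not_false_iff,
            reduceCtorEq, false_iff]
          intro hs
          obtain rfl := Option.some_inj.1 hs
          exact hj (e ⟨i, hi⟩).2
        · simp only [hi, hj, dif_pos, dif_neg, not_false_iff,
            reduceCtorEq, iff_false]
          intro hs
          obtain rfl := Option.some_inj.1 hs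
          exact hi (e.symm ⟨j, hj⟩).2
        · simp [hi, hj] }
  have hσ : ∀ i, σ i = if hi : D.death i = none then some (e ⟨i, hi⟩).1 else none := fun i => rfl
  have hσ' : ∀ j, σ.symm j = if hj : E.death j = none then some (e.symm ⟨j, hj⟩).1 else none :=
    fun j => rfl
  have hhalf : ∀ p ∈ G, ∀ q ∈ G, v ≤ (φ q - φ p) / 2 → v ≤ B := by
    intro p hp q hq hle
    have := (le_abs_self _).trans (hB q hq p hp)
    linarith
  rcases hv σ with ⟨i, j, hij, hle⟩ | ⟨i, hi, hle⟩ | ⟨j, hj, hle⟩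
  · rw [hσ] at hij
    by_cases hi : D.death i = none
    · rw [dif_pos hi, Option.some_inj] at hij
      have hj : E.death j = none := hij ▸ (e ⟨i, hi⟩).2
      rw [hi, hj] at hle
      rcases hle with hle | hle
      · exact hle.trans (hB _ (hD.1 i) _ (hE.1 j))
      · exact hle.elim
    · rw [dif_neg hi] at hij
      cases hij
  · rw [hσ] at hi
    cases hd : D.death i with
    | none => rw [dif_pos hd] at hi; cases hi
    | some q =>
      rw [hd] at hle
      exact hhalf _ (hD.1 i) q (hD.2 i q hd) hle
  · rw [hσ'] at hj
    cases hd : E.death j with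
    | none => rw [dif_pos hd] at hj; cases hj
    | some q =>
      rw [hd] at hle
      exact hhalf _ (hE.1 j) q (hE.2 j q hd) hle

end BigradedDiagram

/-! ### Maxima of two functions -/

/-- Maxima of two elements of `A`. -/
def IsMaxOf {X : Type*} (A : Submodule ℚ (X → ℝ)) (φ : X → ℝ) : Prop :=
  ∃ f ∈ A, ∃ g ∈ A, φ = fun x => max (f x) (g x)

namespace IsMaxOf

variable {X : Type*} {A : Submodule ℚ (X → ℝ)} {φ ψ v : X → ℝ}

theorem le (hφ : IsMaxOf A φ) (hψ : IsMaxOf A ψ) : SemilinearPred A (fun x => φ x ≤ ψ x) := by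
  obtain ⟨f, hf, g, hg, rfl⟩ := hφ
  obtain ⟨f', hf', g', hg', rfl⟩ := hψ
  exact (((SemilinearPred.le hf hf').or (.le hf hg')).and
    ((SemilinearPred.le hg hf').or (.le hg hg'))).congr fun x => by
      rw [max_le_iff, le_max_iff, le_max_iff]

theorem add_left (hφ : IsMaxOf A φ) (hv : v ∈ A) : IsMaxOf A (fun x => v x + φ x) := by
  obtain ⟨f, hf, g, hg, rfl⟩ := hφ
  exact ⟨v + f, A.add_mem hv hf, v + g, A.add_mem hv hg, by
    ext x; simp [max_add_add_left]⟩

/-- A difference of maxima need not be a maximum, so `ψ` is first moved to the other side. -/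
theorem le_sub (hφ : IsMaxOf A φ) (hψ : IsMaxOf A ψ) (hv : v ∈ A) :
    SemilinearPred A (fun x => v x ≤ φ x - ψ x) :=
  ((hψ.add_left hv).le hφ).congr fun _ => le_sub_iff_add_le

theorem le_abs_sub (hφ : IsMaxOf A φ) (hψ : IsMaxOf A ψ) (hv : v ∈ A) :
    SemilinearPred A (fun x => v x ≤ |φ x - ψ x|) :=
  ((hφ.le_sub hψ hv).or (hψ.le_sub hφ hv)).congr fun x => by rw [le_abs, neg_sub]

theorem le_half_sub (hφ : IsMaxOf A φ) (hψ : IsMaxOf A ψ) (hv : v ∈ A) :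
    SemilinearPred A (fun x => v x ≤ (φ x - ψ x) / 2) :=
  (hφ.le_sub hψ (A.add_mem hv hv)).congr fun x => by
    rw [le_div_iff₀ two_pos, mul_two, Pi.add_apply]

end IsMaxOf

namespace BigradedDiagram

/-- The quantifiers range over finitely many matchings and points, and each atomic comparison is
between maxima of elements of `A`. -/
theorem semilinearPred_leBottleneck {X : Type*} {A : Submodule ℚ (X → ℝ)} {D E : BigradedDiagram}
    {G : Set (ℝ × ℝ)} (hD : D.GradesIn G) (hE : E.GradesIn G) {φ : X → ℝ × ℝ → ℝ}
    (hφ : ∀ p ∈ G, IsMaxOf A (fun x => φ x p)) {v : X → ℝ} (hv : v ∈ A) :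
    SemilinearPred A (fun x => LeBottleneck D E (φ x) (v x)) := by
  have hhalf : ∀ p ∈ G, ∀ d : Option (ℝ × ℝ), (∀ q ∈ d, q ∈ G) →
      SemilinearPred A (fun x => LeHalfLength (φ x) (v x) p d) := by
    intro p hp d hd
    cases d with
    | none => exact .const A True
    | some q => exact (hφ q (hd q rfl)).le_half_sub (hφ p hp) hv
  have hdist : ∀ d d' : Option (ℝ × ℝ), (∀ q ∈ d, q ∈ G) → (∀ q ∈ d', q ∈ G) →
      SemilinearPred A (fun x => LeDeathDist (φ x) (v x) d d') := by
    intro d d' hd hd'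
    rcases d with _ | p <;> rcases d' with _ | q
    · exact .const A False
    · exact .const A True
    · exact .const A True
    · exact (hφ p (hd p rfl)).le_abs_sub (hφ q (hd' q rfl)) hv
  refine (SemilinearPred.le hv A.zero_mem).or (.forall_finite fun σ => .or ?_ (.or ?_ ?_))
  · refine .exists_finite fun i => .exists_finite fun j => (SemilinearPred.const A _).and
      (.or ?_ (hdist _ _ (hD.2 i) (hE.2 j)))
    exact (hφ _ (hD.1 i)).le_abs_sub (hφ _ (hE.1 j)) hv
  · exact .exists_finite fun i => (SemilinearPred.const A _).and (hhalf _ (hD.1 i) _ (hD.2 i))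
  · exact .exists_finite fun j => (SemilinearPred.const A _).and (hhalf _ (hE.1 j) _ (hE.2 j))

end BigradedDiagram

/-! ## Rationality of the matching distance -/

/-- Passes from a supremum in `[0, ∞]` to one of a set of reals, to which elimination applies. All
`v ≤ 0` belong to the set, so it is nonempty. -/
theorem ENNReal.iSup_eq_ofReal_sSup {ι : Type*} [Nonempty ι] (f : ι → ℝ≥0∞)
    (hbdd : BddAbove {v : ℝ | ∃ i, ENNReal.ofReal v ≤ f i}) :
    ⨆ i, f i = ENNReal.ofReal (sSup {v : ℝ | ∃ i, ENNReal.ofReal v ≤ f i}) := by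
  have hle : ∀ i, f i ≤ ENNReal.ofReal (sSup {v : ℝ | ∃ i, ENNReal.ofReal v ≤ f i}) := by
    intro i
    by_contra! hlt
    obtain ⟨v, -, h1, h2⟩ := ENNReal.lt_iff_exists_real_btwn.1 hlt
    exact h1.not_ge (ENNReal.ofReal_le_ofReal (le_csSup hbdd ⟨i, h2.le⟩))
  refine le_antisymm (iSup_le hle) ?_
  have htop : ⨆ i, f i ≠ ∞ := ne_top_of_le_ne_top ENNReal.ofReal_ne_top (iSup_le hle)
  refine ENNReal.ofReal_le_of_le_toReal (csSup_le ?_ ?_)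
  · exact ⟨0, Classical.arbitrary ι, by simp⟩
  · rintro v ⟨i, hi⟩
    exact (ENNReal.ofReal_le_iff_le_toReal htop).1 (hi.trans (le_iSup f i))

/-- The slices are covered by two charts, `(1/s, t/s)` for `s ≥ 1` and `(s, t)` for `s < 1`, in
which the weighted push is piecewise affine. -/
theorem exists_slice_weightedPush_iff (F : (ℝ × ℝ → ℝ) → Prop) :
    (∃ l : Slice, F l.weightedPush) ↔ ∃ a b : ℝ,
      ((0 < a ∧ a ≤ 1) ∧ F fun p => max p.1 (a * p.2 - b)) ∨
      ((0 < a ∧ a < 1) ∧ F fun p => max (a * p.1) (p.2 - b)) := by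
  constructor
  · rintro ⟨l, hl⟩
    have hs := l.s_pos
    rcases le_or_gt 1 l.s with h | h
    · refine ⟨1 / l.s, l.t / l.s, Or.inl ⟨⟨by positivity, (div_le_one hs).2 h⟩, ?_⟩⟩
      rwa [← funext fun p => l.weightedPush_of_one_le h p]
    · refine ⟨l.s, l.t, Or.inr ⟨⟨hs, h⟩, ?_⟩⟩
      rwa [← funext fun p => l.weightedPush_of_lt_one h p]
  · rintro ⟨a, b, ⟨⟨ha, ha1⟩, h⟩ | ⟨⟨ha, ha1⟩, h⟩⟩
    · let l : Slice := ⟨1 / a, b / a, by positivity⟩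
      have hl : l.weightedPush = fun p => max p.1 (a * p.2 - b) := by
        ext p
        rw [l.weightedPush_of_one_le ((one_le_div ha).2 ha1) p, one_div_one_div,
          div_div_div_cancel_right₀ ha.ne', div_one]
      exact ⟨l, hl ▸ h⟩
    · refine ⟨⟨a, b, ha⟩, ?_⟩
      rwa [funext fun p => Slice.weightedPush_of_lt_one ⟨a, b, ha⟩ ha1 p]

/-- The rational affine functions of `(v, a, b)`. -/
def ratAffine : Submodule ℚ (((Unit × ℝ) × ℝ) × ℝ → ℝ) :=
  adjoinCoord (adjoinCoord (adjoinCoord ratConst))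

theorem const_mem_ratAffine (q : ℚ) : (fun _ => (q : ℝ)) ∈ ratAffine :=
  comp_fst_mem_adjoinCoord (comp_fst_mem_adjoinCoord (comp_fst_mem_adjoinCoord
    (show (fun _ => (q : ℝ)) ∈ ratConst from ⟨q, rfl⟩)))

/-- This is where rational grades are needed: `p.1` is a constant term and `p.2` the coefficient of
a chart coordinate. -/
theorem isMaxOf_steep_chart {p : ℝ × ℝ} (hp : ∃ q r : ℚ, p = ((q : ℝ), (r : ℝ))) :
    IsMaxOf ratAffine (fun x => max p.1 (x.1.2 * p.2 - x.2)) := by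
  obtain ⟨q, r, rfl⟩ := hp
  refine ⟨_, const_mem_ratAffine q, _, ratAffine.sub_mem (ratAffine.smul_mem r
    (comp_fst_mem_adjoinCoord (snd_mem_adjoinCoord _))) (snd_mem_adjoinCoord _), ?_⟩
  ext x
  simp [Rat.smul_def, mul_comm]

theorem isMaxOf_flat_chart {p : ℝ × ℝ} (hp : ∃ q r : ℚ, p = ((q : ℝ), (r : ℝ))) :
    IsMaxOf ratAffine (fun x => max (x.1.2 * p.1) (p.2 - x.2)) := by
  obtain ⟨q, r, rfl⟩ := hp
  refine ⟨_, ratAffine.smul_mem q (comp_fst_mem_adjoinCoord (snd_mem_adjoinCoord _)), _,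
    ratAffine.sub_mem (const_mem_ratAffine r) (snd_mem_adjoinCoord _), ?_⟩
  ext x
  simp [Rat.smul_def, mul_comm]

/-- A condition that is semilinear in the values of the weighted push at rational points has, over
all slices, a rational supremum. -/
theorem exists_rat_eq_sSup_slices (G : Set (ℝ × ℝ))
    (hG : ∀ p ∈ G, ∃ q r : ℚ, p = ((q : ℝ), (r : ℝ))) (F : (ℝ × ℝ → ℝ) → ℝ → Prop)
    (hF : ∀ φ : ((Unit × ℝ) × ℝ) × ℝ → ℝ × ℝ → ℝ, (∀ p ∈ G, IsMaxOf ratAffine fun x => φ x p) →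
      SemilinearPred ratAffine (fun x => F (φ x) x.1.1.2))
    (hne : {v | ∃ l : Slice, F l.weightedPush v}.Nonempty)
    (hbdd : BddAbove {v | ∃ l : Slice, F l.weightedPush v}) :
    ∃ q : ℚ, sSup {v | ∃ l : Slice, F l.weightedPush v} = q := by
  have ha : (fun x => x.1.2) ∈ ratAffine := comp_fst_mem_adjoinCoord (snd_mem_adjoinCoord _)
  have h0 : (fun _ => 0) ∈ ratAffine := ratAffine.zero_mem
  have h1 : (fun _ => 1) ∈ ratAffine := by simpa using const_mem_ratAffine 1
  have hp : SemilinearPred ratAffine (fun x =>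
      ((0 < x.1.2 ∧ x.1.2 ≤ 1) ∧ F (fun p => max p.1 (x.1.2 * p.2 - x.2)) x.1.1.2) ∨
      ((0 < x.1.2 ∧ x.1.2 < 1) ∧ F (fun p => max (x.1.2 * p.1) (p.2 - x.2)) x.1.1.2)) :=
    .or (.and (.and (.lt h0 ha) (.le ha h1))
      (hF (fun x p => max p.1 (x.1.2 * p.2 - x.2)) fun p hp => isMaxOf_steep_chart (hG p hp)))
      (.and (.and (.lt h0 ha) (.lt ha h1))
      (hF (fun x p => max (x.1.2 * p.1) (p.2 - x.2)) fun p hp => isMaxOf_flat_chart (hG p hp)))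
  have hc0 : (fun _ => 1) ∈ ratConst := ⟨1, by simp⟩
  -- The variables are nested as `v`, `a`, `b`, so `b` is eliminated before `a`.
  have hp' := (hp.exists_snd (comp_fst_mem_adjoinCoord (comp_fst_mem_adjoinCoord hc0))).exists_snd
    (comp_fst_mem_adjoinCoord hc0)
  have hset : {v | ∃ l : Slice, F l.weightedPush v} = {v : ℝ | ∃ a b : ℝ,
      ((0 < a ∧ a ≤ 1) ∧ F (fun p => max p.1 (a * p.2 - b)) v) ∨
      ((0 < a ∧ a < 1) ∧ F (fun p => max (a * p.1) (p.2 - b)) v)} :=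
    Set.ext fun v => exists_slice_weightedPush_iff fun φ => F φ v
  rw [hset] at hne hbdd ⊢
  exact hp'.exists_rat_eq_sSup hne hbdd

theorem FinitePresentation.HasRationalGrades.exists_rat {K : Type u} [Field K]
    {P : FinitePresentation K (ℝ × ℝ)} (hP : P.HasRationalGrades) (i) :
    ∃ q r : ℚ, P.grade i = ((q : ℝ), (r : ℝ)) := by
  cases i with
  | inl i => exact hP.1 i
  | inr j => exact hP.2 j

theorem FinitePresentation.Presents.isDiagram_slice {K : Type u} [Field K]
    {P : FinitePresentation K (ℝ × ℝ)} {M : PersistenceModule.{u, v} K (ℝ × ℝ)}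
    (h : P.Presents M) {l : Slice} {D : PersistenceDiagram}
    (hD : (P.toModule.slice l).IsDiagram D) : (M.slice l).IsDiagram D := by
  obtain ⟨f⟩ := h
  obtain ⟨g⟩ := hD
  exact ⟨(f.pullback l.param).trans g⟩

theorem mainTheorem4 {K : Type u} [Field K] [Finite K]
    (M : PersistenceModule.{u, v} K (ℝ × ℝ)) (N : PersistenceModule.{u, z} K (ℝ × ℝ))
    (P Q : FinitePresentation K (ℝ × ℝ)) (hP : P.Presents M) (hQ : Q.Presents N)
    (hPrat : P.HasRationalGrades) (hQrat : Q.HasRationalGrades) :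
    (∀ l : Slice, PersistenceModule.bottleneckDist (M.slice l) (N.slice l) = ∞) ∨
      ∃ q : ℚ≥0, PersistenceModule.matchingDist M N = ((q : ℝ≥0) : ℝ≥0∞) := by
  choose D hDG hD using P.exists_bigradedDiagram
  choose E hEG hE using Q.exists_bigradedDiagram
  let G : Set (ℝ × ℝ) := Set.range P.grade ∪ Set.range Q.grade
  have hDG' : ∀ r, (D r).GradesIn G := fun r =>
    ⟨fun i => Or.inl ((hDG r).1 i), fun i p hp => Or.inl ((hDG r).2 i p hp)⟩
  have hEG' : ∀ r, (E r).GradesIn G := fun r =>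
    ⟨fun i => Or.inr ((hEG r).1 i), fun i p hp => Or.inr ((hEG r).2 i p hp)⟩
  have hG : ∀ p ∈ G, ∃ q r : ℚ, p = ((q : ℝ), (r : ℝ)) := by
    rintro _ (⟨i, rfl⟩ | ⟨i, rfl⟩)
    exacts [hPrat.exists_rat i, hQrat.exists_rat i]
  have hw : ∀ (l : Slice) p q, l.weightedPush p ≤ l.weightedPush q ↔ l.push p ≤ l.push q :=
    fun l p q => mul_le_mul_iff_right₀ l.weight_pos
  -- The relations `r` and `r'` record the preorders of the grades, which select the bigraded
  -- diagrams. Quantifying over these finitely many relations keeps the condition semilinear.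
  let F : (ℝ × ℝ → ℝ) → ℝ → Prop := fun φ v => ∃ r r',
    (∀ i j, φ (P.grade i) ≤ φ (P.grade j) ↔ r i j) ∧
    (∀ i j, φ (Q.grade i) ≤ φ (Q.grade j) ↔ r' i j) ∧
    BigradedDiagram.LeBottleneck (D r) (E r') φ v
  have hdist : ∀ (l : Slice) r r', (∀ i j, l.push (P.grade i) ≤ l.push (P.grade j) ↔ r i j) →
      (∀ i j, l.push (Q.grade i) ≤ l.push (Q.grade j) ↔ r' i j) → ∀ v : ℝ,
      (ENNReal.ofReal v ≤ ENNReal.ofReal l.weight *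
        PersistenceModule.bottleneckDist (M.slice l) (N.slice l) ↔
      BigradedDiagram.LeBottleneck (D r) (E r') l.weightedPush v) := by
    intro l r r' hr hr' v
    obtain ⟨h, hdiag⟩ := (hD r l hr).2
    obtain ⟨h', hdiag'⟩ := (hE r' l hr').2
    rw [PersistenceModule.bottleneckDist_eq_of_isDiagram (hP.isDiagram_slice hdiag)
      (hQ.isDiagram_slice hdiag')]
    exact BigradedDiagram.ofReal_le_mul_bottleneckDist_iff _ _ l.weight_pos _ _ _ v
  have hF : ∀ (l : Slice) v, ENNReal.ofReal v ≤ ENNReal.ofReal l.weight *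
      PersistenceModule.bottleneckDist (M.slice l) (N.slice l) ↔ F l.weightedPush v := by
    intro l v
    constructor
    · intro h
      exact ⟨_, _, fun i j => hw l _ _, fun i j => hw l _ _,
        (hdist l _ _ (fun i j => Iff.rfl) (fun i j => Iff.rfl) v).1 h⟩
    · rintro ⟨r, r', hr, hr', h⟩
      exact (hdist l r r' (fun i j => (hw l _ _).symm.trans (hr i j))
        (fun i j => (hw l _ _).symm.trans (hr' i j)) v).2 h
  -- Equality of the numbers of infinite points, rows minus rank on each side, written without
  -- subtraction.
  by_cases hinf : P.numRows + Module.finrank K (Submodule.span K (Set.range Q.col)) =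
      Q.numRows + Module.finrank K (Submodule.span K (Set.range P.col))
  swap
  · refine Or.inl fun l => ?_
    have hmul : ENNReal.ofReal l.weight *
        PersistenceModule.bottleneckDist (M.slice l) (N.slice l) = ∞ := by
      refine ENNReal.eq_top_of_forall_nnreal_le fun v => ?_
      rw [← ENNReal.ofReal_coe_nnreal]
      refine (hdist l _ _ (fun i j => Iff.rfl) (fun i j => Iff.rfl) v).2
        (BigradedDiagram.leBottleneck_of_numInfinite_ne ?_ _ _)
      have h1 := (hD _ l (fun i j => Iff.rfl)).1
      have h2 := (hE _ l (fun i j => Iff.rfl)).1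
      omega
    by_contra hne
    exact ENNReal.mul_ne_top ENNReal.ofReal_ne_top hne hmul
  · right
    obtain ⟨B, hB⟩ := Metric.isBounded_iff.1
      ((Set.finite_range P.grade).union (Set.finite_range Q.grade)).isBounded
    have hbdd : BddAbove {v | ∃ l : Slice, F l.weightedPush v} := by
      refine ⟨max B 0, ?_⟩
      rintro v ⟨l, r, r', hr, hr', hv⟩
      refine BigradedDiagram.le_of_leBottleneck ?_ (hDG' r) (hEG' r') (le_max_right _ _)
        (fun p hp q hq => (l.abs_weightedPush_sub_le p q).trans
          ((hB hp hq).trans (le_max_left _ _))) hv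
      have h1 := (hD r l (fun i j => (hw l _ _).symm.trans (hr i j))).1
      have h2 := (hE r' l (fun i j => (hw l _ _).symm.trans (hr' i j))).1
      omega
    let l₀ : Slice := ⟨1, 0, one_pos⟩
    -- Gives both nonemptiness of the set and nonnegativity of its supremum.
    have h0 : (0 : ℝ) ∈ {v | ∃ l : Slice, F l.weightedPush v} :=
      ⟨l₀, (hF l₀ 0).1 (by simp)⟩
    obtain ⟨q, hq⟩ := exists_rat_eq_sSup_slices G hG F (fun φ hφ => by
      refine .exists_finite fun r => .exists_finite fun r' => .and ?_ (.and ?_ ?_)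
      · exact .forall_finite fun i => .forall_finite fun j =>
          ((hφ _ (Or.inl ⟨i, rfl⟩)).le (hφ _ (Or.inl ⟨j, rfl⟩))).iff (.const _ _)
      · exact .forall_finite fun i => .forall_finite fun j =>
          ((hφ _ (Or.inr ⟨i, rfl⟩)).le (hφ _ (Or.inr ⟨j, rfl⟩))).iff (.const _ _)
      · exact BigradedDiagram.semilinearPred_leBottleneck (hDG' r) (hEG' r') hφ
          (comp_fst_mem_adjoinCoord (comp_fst_mem_adjoinCoord (snd_mem_adjoinCoord _)))) ⟨0, h0⟩ hbdd
    have hq0 : 0 ≤ q := by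
      have : (0 : ℝ) ≤ q := hq ▸ le_csSup hbdd h0
      exact_mod_cast this
    have : Nonempty Slice := ⟨l₀⟩
    have hset : {v : ℝ | ∃ l : Slice, ENNReal.ofReal v ≤ ENNReal.ofReal l.weight *
        PersistenceModule.bottleneckDist (M.slice l) (N.slice l)} =
        {v | ∃ l : Slice, F l.weightedPush v} :=
      Set.ext fun v => exists_congr fun l => hF l v
    refine ⟨⟨q, hq0⟩, ?_⟩
    rw [PersistenceModule.matchingDist, ENNReal.iSup_eq_ofReal_sSup _ (by rwa [hset]), hset, hq,
      ENNReal.ofReal, ENNReal.coe_inj]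
    ext
    rw [Real.coe_toNNReal _ (by exact_mod_cast hq0)]
    rfl
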